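/- **Setting.** Let $\mathcal C=\mathcal C_E\uplus\mathcal C_O$ be a finite set of colors and $d\in\mathbb N$. A game $G$ consists of a finite directed graph whose vertex set is partitioned into the vertices $V_E$ of player $E$ and $V_O$ of player $O$, a rank function $rank:V\to\{0,\dots,d-1\}$ and a coloring $V\to\mathcal C$ that colors the vertices of $V_X$ by colors of $\mathcal C_X$. A subgame $G'$ of $G$ has $V'_E\subseteq V_E$, $V'_O\subseteq V_O$, $E'\subseteq E$, and the restricted rank and color functions. It is played as a *stop parity game*: the token moves along edges, the owner of the current vertex choosing the edge; at his vertices $E$ may also execute STOP, which ends the play in a draw; a play ends otherwise only when no move is possible. A finite play that gets stuck at a vertex of $O$ is won by $E$; an infinite play is won by $E$ iff the highest rank occurring infinitely often is even; every other play that is not a draw is lost by $E$. A strategy $\rho$ of $E$ may depend on the history; it is positional if it depends only on the current vertex, and safe from $v$ if no play from $v$ consistent with $\rho$ is lost by $E$. Order the natural numbers by $\dots\prec 5\prec 3\prec 1\prec 0\prec 2\prec 4\prec\cdots$. An *enforcement* is a partial function $P:\mathcal C\rightharpoonup\{0,\dots,d-1\}$, and $P\sqsubseteq Q$ means $\mathrm{dom}\,P\subseteq\mathrm{dom}\,Q$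 and $Q(a)\preceq P(a)$ for all $a\in\mathrm{dom}\,P$. The enforcement $\mathrm{enf}_G(\rho,v)$ maps a color $c$ to the $\preceq$-least number among the maximal ranks of the finite prefixes, ending at some vertex $w$ of color $c$, of plays from $v$ consistent with $\rho$, where for $w\in V_E$ only the prefixes after which $\rho$ executes STOP count; it is undefined at $c$ if there are none. A set $S$ of enforcements is *valid for $v$ in $G$* if 1. (sound) for each $P\in S$ there is a (possibly non-positional) strategy $\rho$ of $E$, safe from $v$ in $G$, with $\mathrm{enf}_G(\rho,v)\sqsubseteq P$; 2. (complete) $\mathrm{enf}_G(\rho,v)\in S$ for each positional strategy $\rho$ of $E$ that is safe from $v$ in $G$; 3. (up-closed) $P\in S$ and $P\sqsubseteq Q$ imply $Q\in S$. For enforcements $P,Q$ and a color $c$ put $(Q\uparrow r)(a)=\max(Q(a),r)$ on $\mathrm{dom}\,Q$, let $P\sqcup Q$ be the pointwise $\preceq$-minimum (the defined value if only one is defined), and let $P[c\mapsto r]$ be $P$ with its value at $c$ replaced by $r$ ($\bot$ means undefined). For $c\notin\mathrm{dom}\,P$ put $\mathrm{mrg}_X(P,c,Q)=P$; for $c\in\mathrm{dom}\,P$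 put $$\mathrm{mrg}_O(P,c,Q)=P\sqcup(Q\uparrow P(c)),\qquad \mathrm{mrg}_E(P,c,Q)=P[c\mapsto\bot]\sqcup(Q\uparrow P(c)).$$ **The update gadget** for a pair $(s,t)$ of colors is the following Boolean circuit. Its input bits are $\mathrm{ECOLOR}$ (is $s\in\mathcal C_E$?) and, for each vertex $v$ of $G$, $\mathrm{USED}[v]$ (is $v\in V'$?), $\mathrm{COL}_v[c]$ for $c\in\mathcal C$ (the one-hot encoded color of $v$), and $\mathrm{IN}_v[P]$ for each enforcement $P$. Its output bits are $\mathrm{OUT}_v[P]=(\mathrm{OUT}^E_v[P]\wedge\mathrm{ECOLOR})\vee(\mathrm{OUT}^O_v[P]\wedge\neg\mathrm{ECOLOR})$, where $$\mathrm{MOVE}[P]=\bigvee_w \mathrm{USED}[w]\wedge\mathrm{COL}_w[t]\wedge\mathrm{IN}_w[P],\qquad \mathrm{LOOPED}[P]=(s\notin\mathrm{dom}\,P)\wedge\bigvee_{2r\in\{0,\dots,d-1\}}\mathrm{MOVE}[P[s\mapsto 2r]],$$ $$\mathrm{OPT}[P]=\mathrm{MOVE}[P]\vee\mathrm{LOOPED}[P],$$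 $$\mathrm{OUT}^E_v[P]=\mathrm{USED}[v]\wedge\Big(\bigvee_{S\sqsubseteq P}\mathrm{IN}_v[S]\ \vee\bigvee_{(Q,R):\,\mathrm{mrg}_E(Q,s,R)\sqsubseteq P}\mathrm{IN}_v[Q]\wedge\mathrm{OPT}[R]\Big),$$ $$\mathrm{GOOD}[Q,P]=\bigwedge_w\Big(\neg\mathrm{USED}[w]\vee\neg\mathrm{COL}_w[t]\vee\bigvee_{R:\ R(s)\text{ is even or undefined},\ \mathrm{mrg}_O(Q,s,R)\sqsubseteq P}\mathrm{IN}_w[R]\Big),$$ $$\mathrm{OUT}^O_v[P]=\mathrm{USED}[v]\wedge\bigvee_{Q\sqsubseteq P}\mathrm{IN}_v[Q]\wedge\big(s\notin\mathrm{dom}\,Q\ \vee\ \mathrm{GOOD}[Q,P]\big).$$ **Lemma.** Let $G'$ be a subgame of a game $G$, let $s,t\in\mathcal C$, and let $G''$ be the game obtained from $G'$ by adding a directed edge from every vertex of color $s$ to every vertex of color $t$. Suppose that the bits $\mathrm{ECOLOR}$, $\mathrm{USED}$ and $\mathrm{COL}$ of the input of the update gadget for $(s,t)$ encode $G'$ and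 the colors as described, and that for each vertex $v$ of $G'$ the set $\{P:\mathrm{IN}_v[P]\text{ is true}\}$ is valid for $v$ in $G'$. Then for each vertex $v$ of $G''$ the set $\{P:\mathrm{OUT}_v[P]\text{ is true}\}$ is valid for $v$ in $G''$. -/

import Mathlib

/-- The two players of a parity game. -/
inductive Player where
  | E
  | O

/-- A parity game with vertices in `V`, ranks in `{0, …, d - 1}`, and a player-aware coloring of its
vertices by colors from `C`, where `player c` is the player to whom the color `c` belongs
(so `C` is the disjoint union of the colors of `E` and the colors of `O`).
The values of `owner`, `rank` and `color` outside `verts` carry no meaning. -/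
structure Game (V : Type*) {C : Type*} (player : C → Player) (d : ℕ) where
  verts : Set V
  owner : V → Player
  adj : V → V → Prop
  rank : V → Fin d
  color : V → C
  adj_mem : ∀ x y, adj x y → x ∈ verts ∧ y ∈ verts
  player_color : ∀ x ∈ verts, player (color x) = owner x

/-- A move of player `E` in a stop parity game: moving the token to a vertex, or `STOP` (called `halt`). -/
inductive Move (V : Type*) where
  | halt
  | go (y : V)

/-- A (possibly history dependent) strategy of player `E`: from the sequence of the vertices visited
before the current one, and the current vertex, it gives the next move. It is total since
`STOP` is always available; its values at vertices of player `O` are never used. -/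
abbrev Strategy (V : Type*) := List V → V → Move V

/-- The plays of a stop parity game: finite ones that end because the owner of the last vertex has
no move, finite ones that end since player `E` executed `STOP` at the last vertex,
and infinite ones. -/
inductive Play (V : Type*) where
  | stuck (p : List V)
  | stopped (p : List V)
  | infinite (f : ℕ → V)

/-- The nonempty finite prefixes `π[… i]` of a play. -/
def Play.prefixes {V : Type*} : Play V → Set (List V)
  | .stuck p => {q | q ≠ [] ∧ q <+: p}
  | .stopped p => {q | q ≠ [] ∧ q <+: p}
  | .infinite f => {q | ∃ i : ℕ, q = (List.range (i + 1)).map f}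

/-- The total order `⪯` : `… 5 ⪯ 3 ⪯ 1 ⪯ 0 ⪯ 2 ⪯ 4 …`. -/
def PrecEq (p q : ℕ) : Prop :=
  (-1 : ℤ) ^ p * (p : ℤ) < (-1 : ℤ) ^ q * (q : ℤ) ∨ p = q

open Classical in
/-- The least element with respect to `⪯`, undefined (`none`) for the empty set. -/
noncomputable def minPrec {d : ℕ} (A : Set (Fin d)) : Option (Fin d) :=
  if h : ∃ m ∈ A, ∀ a ∈ A, PrecEq m a then some h.choose else none

/-- Enforcements: partial functions from colors to `{0, …, d - 1}`. -/
abbrev Enforcement (C : Type*) (d : ℕ) := C → Option (Fin d)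

/-- `P ⊑ Q` : the domain of `P` lies in that of `Q`, and `Q a ⪯ P a` on the domain of `P`. -/
def Enforcement.Le {C : Type*} {d : ℕ} (P Q : Enforcement C d) : Prop :=
  ∀ (a : C) (p : Fin d), P a = some p → ∃ q : Fin d, Q a = some q ∧ PrecEq q p

namespace Game

variable {V C : Type*} {player : C → Player} {d : ℕ}

/-- `G'` is a subgame of `G`. -/
structure IsSubgame (G' G : Game V player d) : Prop where
  verts_subset : G'.verts ⊆ G.verts
  owner_eq : ∀ x ∈ G'.verts, G'.owner x = G.owner x
  adj_imp : ∀ x y, G'.adj x y → G.adj x y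
  rank_eq : ∀ x ∈ G'.verts, G'.rank x = G.rank x
  color_eq : ∀ x ∈ G'.verts, G'.color x = G.color x

/-- The game obtained by adding an edge from every vertex of color `s` to every vertex of
color `t`. -/
def addEdges (G : Game V player d) (s t : C) : Game V player d where
  verts := G.verts
  owner := G.owner
  adj x y := G.adj x y ∨ (x ∈ G.verts ∧ y ∈ G.verts ∧ G.color x = s ∧ G.color y = t)
  rank := G.rank
  color := G.color
  adj_mem := by
    rintro x y (h | ⟨hx, hy, -, -⟩)
    · exact G.adj_mem x y h
    · exact ⟨hx, hy⟩
  player_color := G.player_color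

/-- `ρ` is a strategy of player `E` in the stop parity game `G`: the token only moves along
edges of `G`. -/
def IsStrategy (G : Game V player d) (ρ : Strategy V) : Prop :=
  ∀ (h : List V) (x y : V), x ∈ G.verts → G.owner x = .E → ρ h x = .go y → G.adj x y

/-- The moves of `ρ` do not depend on the history. -/
def IsPositional (G : Game V player d) (ρ : Strategy V) : Prop :=
  ∀ (h h' : List V) (x : V), x ∈ G.verts → G.owner x = .E → ρ h x = ρ h' x

/-- After the vertices `h`, moving the token from `x` to `y` is possible and consistent with `ρ`. -/
def Step (G : Game V player d) (ρ : Strategy V) (h : List V) (x y : V) : Prop :=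
  G.adj x y ∧ (G.owner x = .E → ρ h x = .go y)

/-- `p` is a finite nonempty sequence of moves from `v`, consistent with `ρ`
(and not necessarily exhaustive). -/
def IsPath (G : Game V player d) (ρ : Strategy V) (v : V) (p : List V) : Prop :=
  p.head? = some v ∧ ∀ (h : List V) (x y : V) (r : List V), p = h ++ x :: y :: r → G.Step ρ h x y

/-- The (exhaustive) plays of the stop parity game `G` that start at `v` and are consistent
with `ρ`. A play cannot get stuck at a vertex of player `E`, who may always `STOP`. -/
def playsFrom (G : Game V player d) (ρ : Strategy V) (v : V) : Set (Play V) :=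
  {π | v ∈ G.verts ∧
    match π with
    | .stuck p => G.IsPath ρ v p ∧
        ∃ (h : List V) (x : V), p = h ++ [x] ∧ G.owner x = .O ∧ ∀ y, ¬ G.adj x y
    | .stopped p => G.IsPath ρ v p ∧
        ∃ (h : List V) (x : V), p = h ++ [x] ∧ G.owner x = .E ∧ ρ h x = .halt
    | .infinite f => f 0 = v ∧ ∀ i : ℕ, G.Step ρ ((List.range i).map f) (f i) (f (i + 1))}

/-- The prefixes of these plays that end at `w`. -/
def playsFromTo (G : Game V player d) (ρ : Strategy V) (v w : V) : Set (List V) :=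
  {p | p.getLast? = some w ∧ ∃ π ∈ G.playsFrom ρ v, p ∈ π.prefixes}

/-- `E` wins a finite play that gets stuck at a vertex of `O`, and an infinite play in which the
highest rank that occurs infinitely often is even. -/
def WonByE (G : Game V player d) : Play V → Prop
  | .stuck p => ∃ x : V, p.getLast? = some x ∧ G.owner x = .O
  | .stopped _ => False
  | .infinite f => ∃ m : Fin d,
      IsGreatest {r : Fin d | ∃ᶠ i in Filter.atTop, G.rank (f i) = r} m ∧ Even (m : ℕ)

/-- A play that ends with `STOP` is a draw. -/
def IsDraw : Play V → Prop
  | .stopped _ => True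
  | _ => False

/-- A play is lost by `E` if it is neither won by `E` nor a draw. -/
def LostByE (G : Game V player d) (π : Play V) : Prop :=
  ¬ G.WonByE π ∧ ¬ IsDraw π

/-- `ρ` is safe from `v`: no play from `v` consistent with `ρ` is lost by player `E`. -/
def IsSafe (G : Game V player d) (ρ : Strategy V) (v : V) : Prop :=
  ∀ π ∈ G.playsFrom ρ v, ¬ G.LostByE π

/-- `r` is the maximum rank of the vertices in the sequence `p`. -/
def IsMaxRank (G : Game V player d) (p : List V) (r : Fin d) : Prop :=
  IsGreatest {q : Fin d | ∃ x ∈ p, G.rank x = q} r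

/-- The worst arrival at the vertex `w`, starting from `v` and playing against `ρ`; at a vertex of
player `E`, only the arrivals where `ρ` executes `STOP` count. -/
noncomputable def enforcementV (G : Game V player d) (ρ : Strategy V) (v w : V) :
    Option (Fin d) :=
  minPrec {r | ∃ h : List V, h ++ [w] ∈ G.playsFromTo ρ v w ∧ G.IsMaxRank (h ++ [w]) r ∧
    (G.owner w = .E → ρ h w = .halt)}

/-- The enforcement of `ρ` from `v` in the stop parity game `G`. -/
noncomputable def enforcement (G : Game V player d) (ρ : Strategy V) (v : V) : Enforcement C d :=
  fun c => minPrec {r | ∃ w ∈ G.verts, G.color w = c ∧ G.enforcementV ρ v w = some r}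

/-- A set of enforcements is valid for `v` in `G` if it is sound, complete and up-closed. -/
structure Valid (G : Game V player d) (v : V) (S : Set (Enforcement C d)) : Prop where
  sound : ∀ P ∈ S, ∃ ρ : Strategy V, G.IsStrategy ρ ∧ G.IsSafe ρ v ∧ (G.enforcement ρ v).Le P
  complete : ∀ ρ : Strategy V, G.IsStrategy ρ → G.IsPositional ρ → G.IsSafe ρ v →
    G.enforcement ρ v ∈ S
  upClosed : ∀ P ∈ S, ∀ Q : Enforcement C d, P.Le Q → Q ∈ S

end Game

namespace Enforcement

variable {C : Type*} {d : ℕ}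

/-- `max (Q c) r` on the domain of `Q`, for the usual order of natural numbers. -/
def lift (Q : Enforcement C d) (r : Fin d) : Enforcement C d :=
  fun c => (Q c).map fun q => max q r

open Classical in
/-- The pointwise minimum with respect to `⪯`, equal to the defined one of the two values if the
other one is undefined. -/
noncomputable def union (P Q : Enforcement C d) : Enforcement C d := fun c =>
  match P c, Q c with
  | some p, some q => if PrecEq p q then some p else some q
  | some p, none => some p
  | none, q => q

open Classical in
/-- `P[c ↦ r]`, where `r = none` makes the result undefined at `c`. -/
noncomputable def set (P : Enforcement C d) (c : C) (r : Option (Fin d)) : Enforcement C d :=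
  Function.update P c r

/-- The merge of `P` and `Q` at the color `c`, calculated as if `c` was a color of player `X`. -/
noncomputable def merge (X : Player) (P : Enforcement C d) (c : C) (Q : Enforcement C d) :
    Enforcement C d :=
  match P c, X with
  | some r, .O => P.union (Q.lift r)
  | some r, .E => (P.set c none).union (Q.lift r)
  | none, _ => P

end Enforcement

/-- Boolean circuits with negations and conjunctions and disjunctions of unbounded fan-in, with input
bits in `ι` and one output bit, written as terms (gates that are shared are written repeatedly). -/
inductive Circuit (ι : Type*) where
  | input (i : ι)
  | const (b : Bool)
  | not (g : Circuit ι)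
  | all (n : ℕ) (g : Fin n → Circuit ι)
  | any (n : ℕ) (g : Fin n → Circuit ι)

namespace Circuit

variable {ι : Type*}

/-- The output bit of a circuit. -/
def eval (b : ι → Bool) : Circuit ι → Bool
  | input i => b i
  | const a => a
  | not g => !(g.eval b)
  | all _ g => decide (∀ i, (g i).eval b = true)
  | any _ g => decide (∃ i, (g i).eval b = true)

def and (g h : Circuit ι) : Circuit ι := all 2 ![g, h]

def or (g h : Circuit ι) : Circuit ι := any 2 ![g, h]

/-- Conjunction over a finite index type. -/
noncomputable def bigAnd {α : Type*} [Finite α] (g : α → Circuit ι) : Circuit ι :=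
  all (Nat.card α) fun i => g ((Finite.equivFin α).symm i)

/-- Disjunction over a finite index type. -/
noncomputable def bigOr {α : Type*} [Finite α] (g : α → Circuit ι) : Circuit ι :=
  any (Nat.card α) fun i => g ((Finite.equivFin α).symm i)

/-- The combination gadget (for one output position): the disjunction of the chosen inputs. -/
def choose (m : ℕ) (g cond : Fin m → Circuit ι) : Circuit ι :=
  any m fun j => (g j).and (cond j)

end Circuit

/-- The input bits of the update gadget for a color pair `(s, t)`: whether `s` belongs to player `E`;
for each vertex, whether it belongs to the subgame, the one-hot encoding of its color, and one
bit for each enforcement. -/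
inductive InputBit (V C : Type*) (d : ℕ) where
  | ecolor
  | used (v : V)
  | color (v : V) (c : C)
  | enf (v : V) (P : Enforcement C d)

namespace UpdateGadget

variable {V C : Type*} {d : ℕ}

noncomputable def move [Finite V] (t : C) (P : Enforcement C d) : Circuit (InputBit V C d) :=
  .bigOr fun w : V =>
    (Circuit.input (.used w)).and ((Circuit.input (.color w t)).and (.input (.enf w P)))

noncomputable def looped [Finite V] (s t : C) (P : Enforcement C d) : Circuit (InputBit V C d) :=
  (Circuit.const (P s).isNone).and
    (.bigOr fun r : {r : Fin d // Even (r : ℕ)} => move t (P.set s (some r.1)))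

noncomputable def opt [Finite V] (s t : C) (P : Enforcement C d) : Circuit (InputBit V C d) :=
  (move t P).or (looped s t P)

/-- The output bit for the vertex `v` and the enforcement `P` of the gadget for the case where `s` is
a color of player `E`. -/
noncomputable def updateE [Finite V] [Finite C] (s t : C) (v : V) (P : Enforcement C d) :
    Circuit (InputBit V C d) :=
  (Circuit.input (.used v)).and
    ((Circuit.bigOr fun S : {S : Enforcement C d // S.Le P} => .input (.enf v S.1)).or
      (.bigOr fun QR : {QR : Enforcement C d × Enforcement C d // (QR.1.merge .E s QR.2).Le P} =>
        (Circuit.input (.enf v QR.1.1)).and (opt s t QR.1.2)))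

noncomputable def anyGoodAt [Finite C] (s t : C) (Q P : Enforcement C d) (w : V) :
    Circuit (InputBit V C d) :=
  (Circuit.not (.input (.used w))).or
    ((Circuit.not (.input (.color w t))).or
      (.bigOr fun R : {R : Enforcement C d //
          (∀ r : Fin d, R s = some r → Even (r : ℕ)) ∧ (Q.merge .O s R).Le P} =>
        .input (.enf w R.1)))

noncomputable def anyGood [Finite V] [Finite C] (s t : C) (Q P : Enforcement C d) :
    Circuit (InputBit V C d) :=
  .bigAnd fun w : V => anyGoodAt s t Q P w

/-- The output bit for the vertex `v` and the enforcement `P` of the gadget for the case where `s` is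
a color of player `O`. -/
noncomputable def updateO [Finite V] [Finite C] (s t : C) (v : V) (P : Enforcement C d) :
    Circuit (InputBit V C d) :=
  (Circuit.input (.used v)).and
    (.bigOr fun Q : {Q : Enforcement C d // Q.Le P} =>
      (Circuit.input (.enf v Q.1)).and
        ((Circuit.const (Q.1 s).isNone).or (anyGood s t Q.1 P)))

/-- The output bit of the update gadget for the color pair `(s, t)` at the vertex `v` and the
enforcement `P`. -/
noncomputable def update [Finite V] [Finite C] (s t : C) (v : V) (P : Enforcement C d) :
    Circuit (InputBit V C d) :=
  .choose 2 ![updateE s t v P, updateO s t v P]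
    ![.input .ecolor, .not (.input .ecolor)]

end UpdateGadget

/-! After unfolding the circuit, the output at a vertex is the set `outE` or `outO`, depending on
the owner of `s`. Up-closedness is transitivity of `⊑`; soundness composes strategies, and
completeness cuts a strategy apart.

Soundness. A strategy for the enlarged game is played in phases. It follows a strategy for the old
game until a new edge is used, then starts afresh at the target of that edge (`compose`, `phase`).
If `s` belongs to `E`, a stop at `s` is replaced by a jump to one fixed vertex `w` of color `t`; if
`s` belongs to `O`, a strategy is kept ready for every `w`. A play with finitely many switches ends
in a play of one safe strategy. With infinitely many switches, the highest recurring rank is the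
maximum of some late completed phase, and this is even because every phase after the first that is
left by a switch arrives at `s` with an even rank (`compose_isSafe`). Those even ranks never worsen
a maximum with respect to `⪯`, so an arrival in a later phase is no worse than the first arrival at
`s` merged with an arrival in the last phase (`phase_rank`, `compose_arrives`).

Completeness. A safe positional strategy is restricted to the old game by stopping where it would
use a new edge; the enforcements of the restriction are inputs of the gadget. Positionality allows
paths to be concatenated, and safety makes the maximum rank on every cycle even
(`Leads.even_of_cycle`). If `s` belongs to `O`, every way from `w` to `s` closes to a cycle through
`w`, so its rank is even. If `s` belongs to `E`, different vertices of color `s` may jump to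
different targets, and one target has to stand for all. Among the targets reached with a rank at
most the worst arrival at `s`, one is chosen that is minimal for "reachable through an odd maximum
rank". This relation is transitive and, by safety, irreflexive. From a minimal target, a worst
arrival at `s` that is followed by a further jump has even rank, as `LOOPED` demands
(`outE_complete`). -/

/-! ### The order `⪯` -/

/-- Splitting by parity removes the powers of `-1`, so that all later facts about `⪯` and `max` are
linear arithmetic. -/
theorem precEq_iff (p q : ℕ) : PrecEq p q ↔
    (p % 2 = 1 ∧ (q % 2 = 0 ∨ q ≤ p)) ∨ (p % 2 = 0 ∧ q % 2 = 0 ∧ p ≤ q) := by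
  unfold PrecEq
  rcases Nat.even_or_odd p with hp | hp <;> rcases Nat.even_or_odd q with hq | hq <;>
    simp only [hp.neg_one_pow, hq.neg_one_pow] <;>
    simp only [Nat.even_iff, Nat.odd_iff] at hp hq <;> omega

theorem PrecEq.refl (p : ℕ) : PrecEq p p := Or.inr rfl

theorem PrecEq.trans {p q r : ℕ} (h : PrecEq p q) (h' : PrecEq q r) : PrecEq p r := by
  rw [precEq_iff] at *; omega

theorem PrecEq.total (p q : ℕ) : PrecEq p q ∨ PrecEq q p := by
  simp only [precEq_iff]; omega

theorem PrecEq.even {p q : ℕ} (h : PrecEq p q) (hp : Even p) : Even q := by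
  rw [precEq_iff] at h; rw [Nat.even_iff] at *; omega

theorem PrecEq.max {p q p' q' : ℕ} (h : PrecEq p q) (h' : PrecEq p' q') :
    PrecEq (max p p') (max q q') := by
  rw [precEq_iff] at *; omega

/-- An even rank can only improve a maximum for `E`. Hence completed loops through `s` with an even
rank may be ignored in lower bounds. -/
theorem PrecEq.max_even {p q e : ℕ} (h : PrecEq p q) (he : Even e) : PrecEq p (Max.max q e) := by
  rw [precEq_iff] at *; rw [Nat.even_iff] at he; omega

/-- An odd rank can only worsen a maximum for `E`. This keeps the successor of a target within the
candidate set in `outE_complete`. -/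
theorem PrecEq.max_odd {p q o : ℕ} (h : PrecEq p q) (ho : Odd o) : PrecEq (Max.max p o) q := by
  rw [precEq_iff] at *; rw [Nat.odd_iff] at ho; omega

theorem Fin.coe_max' {d : ℕ} (a b : Fin d) : ((max a b : Fin d) : ℕ) = max (a : ℕ) (b : ℕ) :=
  Fin.val_strictMono.monotone.map_max

theorem exists_precEq_min {d : ℕ} {A : Set (Fin d)} (hA : A.Nonempty) :
    ∃ m ∈ A, ∀ a ∈ A, PrecEq m a := by
  obtain ⟨m, hm, h⟩ := Set.exists_min_image A (fun r : Fin d => (-1 : ℤ) ^ (r : ℕ) * ((r : ℕ) : ℤ))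
    A.toFinite hA
  refine ⟨m, hm, fun a ha => ?_⟩
  rcases (h a ha).lt_or_eq with h' | h'
  · exact Or.inl h'
  · rcases PrecEq.total m a with h'' | h''
    · exact h''
    · rcases h'' with h'' | h''
      · exact absurd h'' (by simp [h'])
      · exact Or.inr h''.symm

theorem minPrec_eq_some {d : ℕ} {A : Set (Fin d)} {r : Fin d} (h : minPrec A = some r) :
    r ∈ A ∧ ∀ a ∈ A, PrecEq r a := by
  unfold minPrec at h
  split_ifs at h with h'
  obtain rfl := Option.some_injective _ h
  exact h'.choose_spec

theorem exists_minPrec {d : ℕ} {A : Set (Fin d)} {a : Fin d} (ha : a ∈ A) :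
    ∃ r, minPrec A = some r ∧ PrecEq r a := by
  have h : ∃ m ∈ A, ∀ a ∈ A, PrecEq m a := exists_precEq_min ⟨a, ha⟩
  refine ⟨h.choose, dif_pos h, h.choose_spec.2 a ha⟩

/-! ### Merges and the order on enforcements -/

namespace Enforcement

variable {C : Type*} {d : ℕ}

theorem Le.trans {P Q R : Enforcement C d} (h : P.Le Q) (h' : Q.Le R) : P.Le R := by
  intro a p hp
  obtain ⟨q, hq, hqp⟩ := h a p hp
  obtain ⟨r, hr, hrq⟩ := h' a q hq
  exact ⟨r, hr, hrq.trans hqp⟩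

/-- Since smaller values are larger for `⊑`, the pointwise `⪯`-minimum is the join. Bounds on merges
therefore split into bounds on their two parts. -/
theorem union_le_iff {P Q R : Enforcement C d} : (P.union Q).Le R ↔ P.Le R ∧ Q.Le R := by
  constructor
  · intro h
    constructor
    · intro a p hp
      cases hq : Q a with
      | none => exact h a p (by simp [union, hp, hq])
      | some q =>
        by_cases hpq : PrecEq p q
        · exact h a p (by simp [union, hp, hq, hpq])
        · obtain ⟨r, hr, hrq⟩ := h a q (by simp [union, hp, hq, hpq])
          exact ⟨r, hr, hrq.trans ((PrecEq.total _ _).resolve_left hpq)⟩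
    · intro a q hq
      cases hp : P a with
      | none => exact h a q (by simp [union, hp, hq])
      | some p =>
        by_cases hpq : PrecEq p q
        · obtain ⟨r, hr, hrq⟩ := h a p (by simp [union, hp, hq, hpq])
          exact ⟨r, hr, hrq.trans hpq⟩
        · exact h a q (by simp [union, hp, hq, hpq])
  · rintro ⟨h₁, h₂⟩ a r hr
    unfold union at hr
    split at hr
    · split_ifs at hr
      · exact h₁ a r (by simp_all)
      · exact h₂ a r (by simp_all)
    · exact h₁ a r (by simp_all)
    · exact h₂ a r hr

theorem lift_le_iff {Q R : Enforcement C d} {r : Fin d} : (Q.lift r).Le R ↔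
    ∀ a q, Q a = some q → ∃ p, R a = some p ∧ PrecEq p (max (r : ℕ) q) := by
  constructor
  · intro h a q hq
    obtain ⟨p, hp, hpq⟩ := h a (max q r) (by simp [lift, hq])
    refine ⟨p, hp, ?_⟩
    rwa [Fin.coe_max', max_comm] at hpq
  · intro h a q hq
    obtain ⟨q', hq', rfl⟩ : ∃ q', Q a = some q' ∧ max q' r = q := by simpa [lift] using hq
    obtain ⟨p, hp, hpq⟩ := h a q' hq'
    refine ⟨p, hp, ?_⟩
    rwa [Fin.coe_max', max_comm]

theorem set_none_le_iff {Q R : Enforcement C d} {s : C} : (Q.set s none).Le R ↔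
    ∀ a q, a ≠ s → Q a = some q → ∃ p, R a = some p ∧ PrecEq p q := by
  constructor
  · intro h a q ha hq
    exact h a q (by simp [set, ha, hq])
  · intro h a q hq
    have ha : a ≠ s := by rintro rfl; simp [set] at hq
    exact h a q ha (by simpa [set, ha] using hq)

theorem merge_none {X : Player} {P Q : Enforcement C d} {c : C} (h : P c = none) :
    P.merge X c Q = P := by
  unfold merge; simp [h]

theorem merge_E {P Q : Enforcement C d} {c : C} {r : Fin d} (h : P c = some r) :
    P.merge .E c Q = (P.set c none).union (Q.lift r) := by
  unfold merge; simp [h]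

theorem merge_O {P Q : Enforcement C d} {c : C} {r : Fin d} (h : P c = some r) :
    P.merge .O c Q = P.union (Q.lift r) := by
  unfold merge; simp [h]

end Enforcement

namespace Game

variable {V C : Type*} {player : C → Player} {d : ℕ} {G : Game V player d} {ρ : Strategy V}

/-! ### Ranks of sequences -/

theorem exists_isMaxRank (G : Game V player d) {p : List V} (hp : p ≠ []) :
    ∃ r, G.IsMaxRank p r := by
  obtain ⟨x, hx⟩ := List.exists_mem_of_ne_nil p hp
  obtain ⟨m, hm, h⟩ := Set.exists_max_image {q : Fin d | ∃ x ∈ p, G.rank x = q} id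
    (Set.toFinite _) ⟨_, x, hx, rfl⟩
  exact ⟨m, hm, h⟩

theorem IsMaxRank.append {p q : List V} {r r' : Fin d} (h : G.IsMaxRank p r)
    (h' : G.IsMaxRank q r') : G.IsMaxRank (p ++ q) (max r r') := by
  constructor
  · obtain ⟨x, hx, hxr⟩ := h.1
    obtain ⟨y, hy, hyr⟩ := h'.1
    rcases le_total r r' with hr | hr
    · exact ⟨y, by simp [hy], by rw [max_eq_right hr, hyr]⟩
    · exact ⟨x, by simp [hx], by rw [max_eq_left hr, hxr]⟩
  · rintro _ ⟨x, hx, rfl⟩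
    rcases List.mem_append.1 hx with hx | hx
    · exact le_max_of_le_left (h.2 ⟨x, hx, rfl⟩)
    · exact le_max_of_le_right (h'.2 ⟨x, hx, rfl⟩)

/-! ### Traces -/

/-- `h` followed by `x` is a finite sequence of moves from `v`, consistent with `ρ`. -/
inductive Trace (G : Game V player d) (ρ : Strategy V) (v : V) : List V → V → Prop
  | nil : Trace G ρ v [] v
  | snoc {h : List V} {x y : V} : Trace G ρ v h x → G.Step ρ h x y → Trace G ρ v (h ++ [x]) y

theorem Trace.isPath {v x : V} {h : List V} (H : G.Trace ρ v h x) : G.IsPath ρ v (h ++ [x]) := by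
  induction H with
  | nil =>
    refine ⟨rfl, fun h x y r e => ?_⟩
    have := congrArg List.length e
    simp at this
    omega
  | @snoc h x y _ hs ih =>
    refine ⟨by have := ih.1; simp_all, fun h' x' y' r e => ?_⟩
    -- The pair of consecutive vertices is either the last one, which is the new step, or lies
    -- within the shorter path.
    rcases List.eq_nil_or_concat r with rfl | ⟨r, z, rfl⟩
    · have e' : (h ++ [x]) ++ [y] = (h' ++ [x']) ++ [y'] := by simpa using e
      obtain ⟨e₁, e₂⟩ := List.append_inj' e' rfl
      obtain ⟨rfl, e₃⟩ := List.append_inj' e₁ rfl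
      simp at e₂ e₃
      subst e₂ e₃
      exact hs
    · have e' : (h ++ [x]) ++ [y] = (h' ++ x' :: y' :: r) ++ [z] := by simpa using e
      exact ih.2 _ _ _ _ (List.append_inj' e' rfl).1

theorem IsPath.trace {v x : V} {h : List V} (H : G.IsPath ρ v (h ++ [x])) : G.Trace ρ v h x := by
  induction h using List.reverseRecOn generalizing x with
  | nil =>
    have := H.1
    simp at this
    subst this
    exact .nil
  | append_singleton h y ih =>
    refine .snoc (ih ⟨by have := H.1; simp_all, fun h' x' y' r e => ?_⟩)
      (H.2 h y x [] (by simp))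
    exact H.2 h' x' y' (r ++ [x]) (by rw [e]; simp)

theorem Trace.eq_of_nil {v x : V} (H : G.Trace ρ v [] x) : x = v := by
  generalize he : ([] : List V) = e at H
  cases H with
  | nil => rfl
  | snoc => simp at he

theorem Trace.mem_verts {v x : V} {h : List V} (H : G.Trace ρ v h x) (hv : v ∈ G.verts) :
    x ∈ G.verts := by
  cases H with
  | nil => exact hv
  | snoc _ hs => exact (G.adj_mem _ _ hs.1).2

theorem trace_of_infinite {v : V} {f : ℕ → V} (h0 : f 0 = v)
    (hf : ∀ i : ℕ, G.Step ρ ((List.range i).map f) (f i) (f (i + 1))) (i : ℕ) :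
    G.Trace ρ v ((List.range i).map f) (f i) := by
  induction i with
  | zero => subst h0; exact .nil
  | succ i ih => rw [List.range_succ, List.map_append]; exact ih.snoc (hf i)

theorem trace_of_mem_playsFromTo {v w : V} {h : List V}
    (H : h ++ [w] ∈ G.playsFromTo ρ v w) : G.Trace ρ v h w := by
  obtain ⟨-, π, hπ, hp⟩ := H
  have key : ∀ p : List V, G.IsPath ρ v p → h ++ [w] <+: p → G.Trace ρ v h w := by
    rintro _ H ⟨r, rfl⟩
    refine IsPath.trace ⟨by have := H.1; cases h <;> simp_all, fun h' x' y' r' e => ?_⟩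
    exact H.2 h' x' y' (r' ++ r) (by rw [e]; simp)
  cases π with
  | stuck p => exact key p hπ.2.1 hp.2
  | stopped p => exact key p hπ.2.1 hp.2
  | infinite f =>
    obtain ⟨i, hi⟩ := hp
    rw [List.range_succ, List.map_append] at hi
    obtain ⟨rfl, e⟩ := List.append_inj' hi rfl
    simp at e
    subst e
    exact trace_of_infinite hπ.2.1 hπ.2.2 i

/-- Every trace can be continued to an exhaustive play. -/
theorem Trace.mem_playsFromTo (hρ : G.IsStrategy ρ) {v w : V} {h : List V} (hv : v ∈ G.verts)
    (H : G.Trace ρ v h w) : h ++ [w] ∈ G.playsFromTo ρ v w := by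
  refine ⟨by simp, ?_⟩
  -- Either some continuation is a dead end, which is a stuck or a stopped play, or every
  -- continuation can be prolonged, and iterating the choice of a next vertex gives an infinite
  -- play.
  by_cases hdead : ∃ h' w', G.Trace ρ v h' w' ∧ h ++ [w] <+: h' ++ [w'] ∧ ∀ y, ¬ G.Step ρ h' w' y
  · obtain ⟨h', w', H', hp, hd⟩ := hdead
    cases ho : G.owner w' with
    | O =>
      refine ⟨.stuck (h' ++ [w']), ⟨hv, H'.isPath, h', w', rfl, ho, fun y hy => hd y ⟨hy, ?_⟩⟩,
        by simp, hp⟩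
      simp [ho]
    | E =>
      refine ⟨.stopped (h' ++ [w']), ⟨hv, H'.isPath, h', w', rfl, ho, ?_⟩, by simp, hp⟩
      cases hm : ρ h' w' with
      | halt => rfl
      | go y => exact absurd ⟨hρ _ _ _ (H'.mem_verts hv) ho hm, fun _ => hm⟩ (hd y)
  · push Not at hdead
    choose nxt hnxt using hdead
    let S := {q : List V × V // G.Trace ρ v q.1 q.2 ∧ h ++ [w] <+: q.1 ++ [q.2]}
    let next : S → S := fun q =>
      ⟨(q.1.1 ++ [q.1.2], nxt q.1.1 q.1.2 q.2.1 q.2.2), q.2.1.snoc (hnxt _ _ _ _),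
        q.2.2.trans (by simp)⟩
    let s : ℕ → S := fun n => next^[n] ⟨(h, w), H, List.prefix_rfl⟩
    have hs : ∀ n, s (n + 1) = next (s n) := fun n => Function.iterate_succ_apply' _ _ _
    have hlen : ∀ n, (s n).1.1.length = h.length + n := by
      intro n
      induction n with
      | zero => simp [s]
      | succ n ih => rw [hs]; simp [next, ih]; omega
    -- The play reads the given history first; `s n` is the trace `n` steps after it.
    let f : ℕ → V := fun i => if hi : i < h.length then h[i] else (s (i - h.length)).1.2
    have hh : (List.range h.length).map f = h := by
      refine List.ext_getElem (by simp) fun i h₁ h₂ => ?_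
      simp [f, h₂]
    have hf : ∀ n, (List.range (h.length + n)).map f = (s n).1.1 := by
      intro n
      induction n with
      | zero => simpa [s] using hh
      | succ n ih =>
        rw [← add_assoc, List.range_succ, List.map_append, ih, hs]
        simp [next, f]
    have hfn : ∀ n, f (h.length + n) = (s n).1.2 := by intro n; simp [f]
    have htr : ∀ i, G.Trace ρ v ((List.range (h.length + i)).map f) (f (h.length + i)) := by
      intro n; rw [hf, hfn]; exact (s n).2.1
    have hpre : ∀ i n, i ≤ n → G.Trace ρ v ((List.range n).map f) (f n) →
        G.Trace ρ v ((List.range i).map f) (f i) := by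
      intro i n hin
      induction n, hin using Nat.le_induction with
      | base => exact id
      | succ n _ ih =>
        intro H
        rw [List.range_succ, List.map_append] at H
        generalize hz : f (n + 1) = z at H
        generalize hq : (List.range n).map f ++ [f n] = q at H ih
        have hq' : (List.range n).map f ++ List.map f [n] = q := hq
        rw [hq'] at H
        cases H with
        | nil => simp at hq
        | snoc H hs =>
          obtain ⟨e₁, e₂⟩ := List.append_inj' hq rfl
          simp at e₂
          subst e₂
          exact ih (by rw [e₁]; exact H)
    have hall : ∀ i, G.Trace ρ v ((List.range i).map f) (f i) :=
      fun i => hpre i (h.length + i) (by omega) (htr i)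
    refine ⟨.infinite f, ⟨hv, ?_, fun i => ?_⟩, h.length, ?_⟩
    · have := (hall 0).isPath.1
      simpa using this
    · refine (hall (i + 1)).isPath.2 _ _ _ [] ?_
      simp [List.range_succ]
    · rw [List.range_succ, List.map_append, hh]
      simp [f, s]

/-! ### Enforcements in terms of traces -/

/-- Some trace from `v` ends at a vertex of color `c`, where the strategy stops if
the color belongs to player `E`, and has the maximum rank `r`. -/
def Arrives (G : Game V player d) (ρ : Strategy V) (v : V) (c : C) (r : Fin d) : Prop :=
  ∃ h w, G.Trace ρ v h w ∧ G.color w = c ∧ G.IsMaxRank (h ++ [w]) r ∧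
    (G.owner w = .E → ρ h w = .halt)

/-- With `Arrives.enforcement`, this replaces the two nested minima and the exhaustive plays by
single traces: values of the enforcement are attained, and they bound all arrivals. -/
theorem arrives_of_enforcement {v : V} {c : C} {r : Fin d}
    (h : G.enforcement ρ v c = some r) : G.Arrives ρ v c r := by
  obtain ⟨⟨w, -, hc, hr⟩, -⟩ := minPrec_eq_some h
  obtain ⟨⟨p, hp, hm, hh⟩, -⟩ := minPrec_eq_some hr
  exact ⟨p, w, trace_of_mem_playsFromTo hp, hc, hm, hh⟩

theorem Arrives.enforcement (hρ : G.IsStrategy ρ) {v : V} (hv : v ∈ G.verts) {c : C} {r : Fin d}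
    (h : G.Arrives ρ v c r) : ∃ q, G.enforcement ρ v c = some q ∧ PrecEq q r := by
  obtain ⟨p, w, H, hc, hm, hh⟩ := h
  obtain ⟨q, hq, hqr⟩ := exists_minPrec (a := r) (A := {r | ∃ h : List V,
    h ++ [w] ∈ G.playsFromTo ρ v w ∧ G.IsMaxRank (h ++ [w]) r ∧ (G.owner w = .E → ρ h w = .halt)})
    ⟨p, H.mem_playsFromTo hρ hv, hm, hh⟩
  obtain ⟨q', hq', hqq⟩ := exists_minPrec (a := q) (A := {r | ∃ w ∈ G.verts, G.color w = c ∧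
    G.enforcementV ρ v w = some r}) ⟨w, H.mem_verts hv, hc, hq⟩
  exact ⟨q', hq', hqq.trans hqr⟩

theorem enforcement_le {v : V} {P : Enforcement C d}
    (h : ∀ c r, G.Arrives ρ v c r → ∃ p, P c = some p ∧ PrecEq p r) :
    (G.enforcement ρ v).Le P :=
  fun c r hr => h c r (arrives_of_enforcement hr)

theorem Arrives.of_enforcement_le (hρ : G.IsStrategy ρ) {v : V} (hv : v ∈ G.verts)
    {P : Enforcement C d} (hP : (G.enforcement ρ v).Le P) {c : C} {r : Fin d}
    (h : G.Arrives ρ v c r) : ∃ p, P c = some p ∧ PrecEq p r := by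
  obtain ⟨q, hq, hqr⟩ := h.enforcement hρ hv
  obtain ⟨p, hp, hpq⟩ := hP c q hq
  exact ⟨p, hp, hpq.trans hqr⟩

/-- Plays get stuck only at vertices of `O`, which `E` wins, and stopped plays are draws. So only
infinite plays can be lost. -/
theorem isSafe_iff {v : V} (hv : v ∈ G.verts) : G.IsSafe ρ v ↔ ∀ f : ℕ → V, f 0 = v →
    (∀ i : ℕ, G.Step ρ ((List.range i).map f) (f i) (f (i + 1))) → G.WonByE (.infinite f) := by
  constructor
  · intro h f h0 hf
    by_contra hw
    exact h (.infinite f) ⟨hv, h0, hf⟩ ⟨hw, id⟩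
  · rintro h (p | p | f) hπ ⟨h₁, h₂⟩
    · obtain ⟨-, -, q, x, rfl, ho, -⟩ := hπ
      exact h₁ ⟨x, by simp, ho⟩
    · exact h₂ trivial
    · exact h₁ (h f hπ.2.1 hπ.2.2)

theorem wonByE_shift (f : ℕ → V) (n : ℕ) :
    G.WonByE (.infinite fun i => f (i + n)) ↔ G.WonByE (.infinite f) := by
  have : ∀ r, (∃ᶠ i in Filter.atTop, G.rank (f (i + n)) = r) ↔
      ∃ᶠ i in Filter.atTop, G.rank (f i) = r := by
    intro r
    conv_rhs => rw [← Filter.map_add_atTop_eq_nat n, Filter.frequently_map]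
  simp only [WonByE, this]

end Game

namespace Game

variable {V C : Type*} {player : C → Player} {d : ℕ}

/-! ### Composition of strategies -/

section Composition

variable (G : Game V player d) (s t : C) (v : V) (σ : Option V → Strategy V)
  (jump : Option V → Option V)

open Classical in
/-- After the vertices `l` (in reverse order) and `x`, the strategy of the family `σ` that is
currently followed (`some w` if it was started at `w` after the last switch, `none` before the first
switch), and the vertices visited since it was started. -/
noncomputable def phase : List V → V → Option V × List V
  | [], _ => (none, [])
  | x :: l, y =>
    if G.Step (σ (phase l x).1) (phase l x).2 x y then
      ((phase l x).1, (phase l x).2 ++ [x])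
    else (some y, [])

open Classical in
/-- The strategy that follows the strategies of the family `σ` by phases; where the
current one stops at a vertex of color `s`, the move may go to a new vertex instead. -/
noncomputable def compose : Strategy V := fun h x =>
  if σ (G.phase σ h.reverse x).1 (G.phase σ h.reverse x).2 x = .halt ∧ G.color x = s then
    match jump (G.phase σ h.reverse x).1 with
    | some w => .go w
    | none => .halt
  else σ (G.phase σ h.reverse x).1 (G.phase σ h.reverse x).2 x

/-- The vertices at which a phase may start right after the phase `φ`. -/
def Target (φ : Option V) (y : V) : Prop :=
  y ∈ G.verts ∧ G.color y = t ∧ (player s = .E → jump φ = some y)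

/-- The phases that may occur. -/
def IsPhase (φ : Option V) : Prop :=
  ∀ w, φ = some w → ∃ φ', G.Target s t jump φ' w

variable {G s t v σ jump}

theorem compose_isStrategy (hσ : ∀ φ, G.IsStrategy (σ φ))
    (hj : ∀ φ w, jump φ = some w → w ∈ G.verts ∧ G.color w = t) :
    (G.addEdges s t).IsStrategy (G.compose s σ jump) := by
  intro h x y hx ho hxy
  unfold compose at hxy
  split_ifs at hxy with hc
  · split at hxy
    · next w hw =>
      cases hxy
      obtain ⟨hw₁, hw₂⟩ := hj _ _ hw
      exact Or.inr ⟨hx, hw₁, hc.2, hw₂⟩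
    · cases hxy
  · exact Or.inl (hσ _ _ _ _ hx ho hxy)

/-- At a vertex of `E`, the composed strategy deviates from the current one only by jumping from a
stop at color `s`. At a vertex of `O`, only the missing edge can prevent the step in the old game,
so a new edge is used. -/
theorem switch (hσ : ∀ φ, G.IsStrategy (σ φ))
    (hj : ∀ φ w, jump φ = some w → w ∈ G.verts ∧ G.color w = t) {h : List V} {x y : V}
    (hs : (G.addEdges s t).Step (G.compose s σ jump) h x y)
    (hn : ¬ G.Step (σ (G.phase σ h.reverse x).1) (G.phase σ h.reverse x).2 x y) :
    G.Target s t jump (G.phase σ h.reverse x).1 y ∧ G.color x = s ∧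
      (G.owner x = .E → σ (G.phase σ h.reverse x).1 (G.phase σ h.reverse x).2 x = .halt) := by
  obtain ⟨ha, hm⟩ := hs
  have hxy := (G.addEdges s t).adj_mem _ _ ha
  have hpc := G.player_color x hxy.1
  change G.owner x = _ → _ at hm
  cases ho : G.owner x with
  | E =>
    specialize hm ho
    unfold compose at hm
    split_ifs at hm with hc
    · split at hm
      · next w hw =>
        cases hm
        exact ⟨⟨hxy.2, (hj _ _ hw).2, fun _ => hw⟩, hc.2, fun _ => hc.1⟩
      · cases hm
    · exact absurd ⟨hσ _ _ _ _ hxy.1 ho hm, fun _ => hm⟩ hn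
  | O =>
    rcases ha with ha | ha
    · exact absurd ⟨ha, fun h => by simp [ho] at h⟩ hn
    · refine ⟨⟨hxy.2, ha.2.2.2, fun h => ?_⟩, ha.2.2.1, fun h => by cases h⟩
      rw [← ha.2.2.1, hpc, ho] at h
      cases h

theorem phase_snoc_pos {h : List V} {x y : V}
    (hs : G.Step (σ (G.phase σ h.reverse x).1) (G.phase σ h.reverse x).2 x y) :
    G.phase σ (h ++ [x]).reverse y =
      ((G.phase σ h.reverse x).1, (G.phase σ h.reverse x).2 ++ [x]) := by
  rw [List.reverse_append, List.reverse_singleton, List.singleton_append, phase, if_pos hs]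

theorem phase_snoc_neg {h : List V} {x y : V}
    (hs : ¬ G.Step (σ (G.phase σ h.reverse x).1) (G.phase σ h.reverse x).2 x y) :
    G.phase σ (h ++ [x]).reverse y = (some y, []) := by
  rw [List.reverse_append, List.reverse_singleton, List.singleton_append, phase, if_neg hs]

theorem phase_trace (hσ : ∀ φ, G.IsStrategy (σ φ))
    (hj : ∀ φ w, jump φ = some w → w ∈ G.verts ∧ G.color w = t) {h : List V} {x : V}
    (H : (G.addEdges s t).Trace (G.compose s σ jump) v h x) :
    G.IsPhase s t jump (G.phase σ h.reverse x).1 ∧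
      G.Trace (σ (G.phase σ h.reverse x).1) ((G.phase σ h.reverse x).1.getD v)
        (G.phase σ h.reverse x).2 x := by
  induction H with
  | nil => exact ⟨(fun w hw => nomatch hw), .nil⟩
  | @snoc h x y H hs ih =>
    by_cases hn : G.Step (σ (G.phase σ h.reverse x).1) (G.phase σ h.reverse x).2 x y
    · rw [phase_snoc_pos hn]
      exact ⟨ih.1, ih.2.snoc hn⟩
    · rw [phase_snoc_neg hn]
      refine ⟨?_, .nil⟩
      rintro _ ⟨⟩
      exact ⟨_, (switch hσ hj hs hn).1⟩

/-- A switch takes place only where the current strategy arrives at the color `s`. -/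
theorem arrives_of_switch (hσ : ∀ φ, G.IsStrategy (σ φ))
    (hj : ∀ φ w, jump φ = some w → w ∈ G.verts ∧ G.color w = t) {h : List V} {x y : V}
    (H : (G.addEdges s t).Trace (G.compose s σ jump) v h x)
    (hs : (G.addEdges s t).Step (G.compose s σ jump) h x y)
    (hn : ¬ G.Step (σ (G.phase σ h.reverse x).1) (G.phase σ h.reverse x).2 x y) {r : Fin d}
    (hr : G.IsMaxRank ((G.phase σ h.reverse x).2 ++ [x]) r) :
    G.Arrives (σ (G.phase σ h.reverse x).1) ((G.phase σ h.reverse x).1.getD v) s r :=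
  ⟨_, x, (phase_trace hσ hj H).2, (switch hσ hj hs hn).2.1, hr, (switch hσ hj hs hn).2.2⟩

/-- Here `a` collects all completed phases. The first of them contributes a rank `⪰ q`, and each
later one an even rank, which preserves this bound. -/
theorem phase_rank (hσ : ∀ φ, G.IsStrategy (σ φ))
    (hj : ∀ φ w, jump φ = some w → w ∈ G.verts ∧ G.color w = t) {q : ℕ}
    (hnone : ∀ y r, G.Target s t jump none y → G.Arrives (σ none) v s r → PrecEq q r)
    (hsome : ∀ w y r, G.IsPhase s t jump (some w) → G.Target s t jump (some w) y →
      G.Arrives (σ (some w)) w s r → Even (r : ℕ)) {h : List V} {x : V}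
    (H : (G.addEdges s t).Trace (G.compose s σ jump) v h x) :
    ((G.phase σ h.reverse x).1 = none ∧ (G.phase σ h.reverse x).2 = h) ∨
      ∃ w a r, (G.phase σ h.reverse x).1 = some w ∧ h = a ++ (G.phase σ h.reverse x).2 ∧
        G.IsMaxRank a r ∧ PrecEq q r := by
  induction H with
  | nil => exact Or.inl ⟨rfl, rfl⟩
  | @snoc h x y H hs ih =>
    by_cases hn : G.Step (σ (G.phase σ h.reverse x).1) (G.phase σ h.reverse x).2 x y
    · rw [phase_snoc_pos hn]
      rcases ih with ⟨h₁, h₂⟩ | ⟨w, a, r, h₁, h₂, h₃⟩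
      · exact Or.inl ⟨h₁, by simp [h₂]⟩
      · refine Or.inr ⟨w, a, r, h₁, ?_, h₃⟩
        rw [← List.append_assoc, ← h₂]
    · rw [phase_snoc_neg hn]
      obtain ⟨r, hr⟩ := G.exists_isMaxRank
        (p := (G.phase σ h.reverse x).2 ++ [x]) (by simp)
      have ht := (switch hσ hj hs hn).1
      have har := arrives_of_switch hσ hj H hs hn hr
      have hph := (phase_trace hσ hj H).1
      refine Or.inr ?_
      rcases ih with ⟨h₁, h₂⟩ | ⟨w, a, r', h₁, h₂, h₃, h₄⟩
      · rw [h₁] at ht har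
        rw [h₂] at hr
        exact ⟨y, h ++ [x], r, rfl, by simp, hr, hnone y r ht har⟩
      · rw [h₁] at ht har hph
        refine ⟨y, h ++ [x], max r' r, rfl, by simp, ?_, ?_⟩
        · have := h₃.append hr
          rwa [← List.append_assoc, ← h₂] at this
        · rw [Fin.coe_max']
          exact h₄.max_even (hsome w y r hph ht har)

/-- An arrival of the composition is an arrival of the current strategy, with the rank `A` of the
completed phases added. At a vertex of `E` with color `s` it counts only if no jump replaces the
stop, hence the conditions on `jump`. -/
theorem compose_arrives (hσ : ∀ φ, G.IsStrategy (σ φ))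
    (hj : ∀ φ w, jump φ = some w → w ∈ G.verts ∧ G.color w = t) (hv : v ∈ G.verts) {q : ℕ}
    (hnone : ∀ y r, G.Target s t jump none y → G.Arrives (σ none) v s r → PrecEq q r)
    (hsome : ∀ w y r, G.IsPhase s t jump (some w) → G.Target s t jump (some w) y →
      G.Arrives (σ (some w)) w s r → Even (r : ℕ)) {c : C} {r : Fin d}
    (H : (G.addEdges s t).Arrives (G.compose s σ jump) v c r) :
    ((c = s → player s = .E → jump none = none) ∧ G.Arrives (σ none) v c r) ∨
      ∃ w r' A, G.IsPhase s t jump (some w) ∧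
        (c = s → player s = .E → jump (some w) = none) ∧
        G.Arrives (σ (some w)) w c r' ∧ PrecEq q A ∧ (r : ℕ) = max A r' := by
  obtain ⟨h, x, H, hc, hr, hh⟩ := H
  change G.color x = c at hc
  change G.owner x = _ → _ at hh
  have hph := phase_trace hσ hj H
  have hpc := G.player_color x (H.mem_verts hv)
  have hE : G.owner x = .E → σ (G.phase σ h.reverse x).1 (G.phase σ h.reverse x).2 x = .halt ∧
      (c = s → jump (G.phase σ h.reverse x).1 = none) := by
    intro ho
    specialize hh ho
    unfold compose at hh
    split_ifs at hh with hcond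
    · split at hh
      · cases hh
      · next hw => exact ⟨hcond.1, fun _ => hw⟩
    · exact ⟨hh, fun hcs => absurd ⟨hh, hc.trans hcs⟩ hcond⟩
  have hjump : c = s → player s = .E → jump (G.phase σ h.reverse x).1 = none := by
    intro hcs hs
    exact (hE (by rw [← hpc, hc, hcs, hs])).2 hcs
  rcases phase_rank hσ hj hnone hsome H with ⟨h₁, h₂⟩ | ⟨w, a, A, h₁, h₂, h₃, h₄⟩
  · rw [h₁] at hph hjump hE
    rw [h₂] at hph hE
    exact Or.inl ⟨hjump, h, x, hph.2, hc, hr, fun ho => (hE ho).1⟩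
  · rw [h₁] at hph hjump hE
    obtain ⟨r', hr'⟩ := G.exists_isMaxRank (p := (G.phase σ h.reverse x).2 ++ [x]) (by simp)
    have := h₃.append hr'
    rw [← List.append_assoc, ← h₂] at this
    refine Or.inr ⟨w, r', A, hph.1, hjump, ⟨_, x, hph.2, hc, hr', fun ho => (hE ho).1⟩, h₄, ?_⟩
    rw [← Fin.coe_max', hr.unique this]

theorem exists_isGreatest_frequently (f : ℕ → Fin d) :
    ∃ m, IsGreatest {r : Fin d | ∃ᶠ i in Filter.atTop, f i = r} m := by
  obtain ⟨r, hr⟩ : ∃ r, ∃ᶠ i in Filter.atTop, f i = r := by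
    by_contra! h
    have : ∀ᶠ i in Filter.atTop, ∀ r, f i ≠ r :=
      Filter.eventually_all.2 h
    obtain ⟨i, hi⟩ := this.exists
    exact hi _ rfl
  obtain ⟨m, hm, h⟩ := Set.exists_max_image {r : Fin d | ∃ᶠ i in Filter.atTop, f i = r} id
    (Set.toFinite _) ⟨r, hr⟩
  exact ⟨m, hm, h⟩

theorem compose_isSafe (hσ : ∀ φ, G.IsStrategy (σ φ))
    (hj : ∀ φ w, jump φ = some w → w ∈ G.verts ∧ G.color w = t) (hv : v ∈ G.verts)
    (hsome : ∀ w y r, G.IsPhase s t jump (some w) → G.Target s t jump (some w) y →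
      G.Arrives (σ (some w)) w s r → Even (r : ℕ))
    (hsafe : ∀ φ, G.IsPhase s t jump φ → G.IsSafe (σ φ) (φ.getD v)) :
    (G.addEdges s t).IsSafe (G.compose s σ jump) v := by
  rw [isSafe_iff (G := G.addEdges s t) hv]
  intro f h0 hf
  change G.WonByE (.infinite f)
  have H : ∀ i, (G.addEdges s t).Trace (G.compose s σ jump) v ((List.range i).map f) (f i) :=
    trace_of_infinite h0 hf
  let Φ : ℕ → Option V × List V := fun i => G.phase σ ((List.range i).map f).reverse (f i)
  let cont : ℕ → Prop := fun i => G.Step (σ (Φ i).1) (Φ i).2 (f i) (f (i + 1))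
  have hpos : ∀ i, cont i → Φ (i + 1) = ((Φ i).1, (Φ i).2 ++ [f i]) := by
    intro i hi
    have := phase_snoc_pos hi
    simpa only [Φ, List.range_succ, List.map_append, List.map_cons, List.map_nil] using this
  have hneg : ∀ i, ¬ cont i → Φ (i + 1) = (some (f (i + 1)), []) := by
    intro i hi
    have := phase_snoc_neg hi
    simpa only [Φ, List.range_succ, List.map_append, List.map_cons, List.map_nil] using this
  have htr : ∀ i, G.IsPhase s t jump (Φ i).1 ∧ G.Trace (σ (Φ i).1) ((Φ i).1.getD v) (Φ i).2 (f i) :=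
    fun i => phase_trace hσ hj (H i)
  by_cases hfin : ∃ N, ∀ i ≥ N, cont i
  -- The least `N` without later switches is `0` or directly follows a switch, so a phase starts
  -- there and the tail of the play is a play of its strategy from its own start.
  · obtain ⟨N, hN, hnil⟩ : ∃ N, (∀ i ≥ N, cont i) ∧ (Φ N).2 = [] := by
      classical
      refine ⟨Nat.find hfin, Nat.find_spec hfin, ?_⟩
      rcases hk : Nat.find hfin with _ | k
      · rfl
      · rw [hneg]
        intro hc
        refine Nat.find_min hfin (m := k) (by omega) fun i hi => ?_
        rcases hi.eq_or_lt with rfl | hi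
        · exact hc
        · exact Nat.find_spec hfin i (by omega)
    have hΦ : ∀ k, Φ (N + k) = ((Φ N).1, (List.range k).map fun j => f (j + N)) := by
      intro k
      induction k with
      | zero => simp [← hnil]
      | succ k ih =>
        rw [← add_assoc, hpos _ (hN _ (by omega)), ih, List.range_succ, List.map_append]
        simp [add_comm]
    have hstart := (htr N).2
    rw [hnil] at hstart
    have hfN : f N = (Φ N).1.getD v := hstart.eq_of_nil
    have hmem : (Φ N).1.getD v ∈ G.verts := hfN ▸ (H N).mem_verts hv
    rw [← wonByE_shift f N]
    refine (isSafe_iff hmem).1 (hsafe _ (htr N).1) _ (by simpa using hfN) fun i => ?_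
    have := hN (N + i) (by omega)
    simp only [cont, hΦ i] at this
    rw [show i + 1 + N = N + i + 1 by omega, add_comm i N]
    exact this
  · push Not at hfin
    obtain ⟨m, hm⟩ := exists_isGreatest_frequently fun i => G.rank (f i)
    refine ⟨m, hm, ?_⟩
    obtain ⟨N, hN⟩ : ∃ N, ∀ i ≥ N, G.rank (f i) ≤ m := by
      have : ∀ᶠ i in Filter.atTop, ∀ r, m < r → G.rank (f i) ≠ r :=
        Filter.eventually_all.2 fun r => by
          by_cases hr : m < r
          · have := mt (@hm.2 r) (not_le.2 hr)
            filter_upwards [Filter.not_frequently.1 this] with i hi _ using hi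
          · exact .of_forall fun i h => absurd h hr
      obtain ⟨N, hN⟩ := Filter.eventually_atTop.1 this
      exact ⟨N, fun i hi => not_lt.1 fun h => hN i hi _ h rfl⟩
    -- After a switch beyond `N`, the current phase is not the first one, to which `hsome` does not
    -- apply, and all its ranks are at most `m`.
    obtain ⟨i₀, hi₀, hc₀⟩ := hfin N
    have hseg : ∀ i ≥ i₀ + 1, (∃ w, (Φ i).1 = some w) ∧
        ∀ x ∈ (Φ i).2 ++ [f i], ∃ k ≥ N, f k = x := by
      intro i hi
      induction i, hi using Nat.le_induction with
      | base =>
        rw [hneg _ hc₀]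
        refine ⟨⟨_, rfl⟩, fun x hx => ⟨i₀ + 1, by omega, (by simpa using hx : x = _).symm⟩⟩
      | succ i hi ih =>
        by_cases hc : cont i
        · rw [hpos i hc]
          refine ⟨ih.1, fun x hx => ?_⟩
          rcases List.mem_append.1 hx with hx | hx
          · exact ih.2 x hx
          · exact ⟨i + 1, by omega, (by simpa using hx : x = _).symm⟩
        · rw [hneg _ hc]
          exact ⟨⟨_, rfl⟩, fun x hx => ⟨i + 1, by omega, (by simpa using hx : x = _).symm⟩⟩
    obtain ⟨j, hj₁, hj₂⟩ := Filter.frequently_atTop.1 hm.1 (i₀ + 1)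
    classical
    -- The first switch from `j` on ends the phase that contains the visit to rank `m` at `j`, so
    -- this phase has maximum rank exactly `m`.
    have hex : ∃ i, j ≤ i ∧ ¬ cont i := hfin j
    obtain ⟨hji, hci⟩ := Nat.find_spec hex
    have hmin := fun i => @Nat.find_min _ _ hex i
    generalize Nat.find hex = i₁ at hji hci hmin
    have hjmem : ∀ i, j ≤ i → i ≤ i₁ → f j ∈ (Φ i).2 ++ [f i] := by
      intro i hi
      induction i, hi using Nat.le_induction with
      | base => simp
      | succ i hi ih =>
        intro hle
        rw [hpos i (by_contra fun h => hmin i (by omega) ⟨hi, h⟩)]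
        exact List.mem_append_left _ (ih (by omega))
    obtain ⟨⟨w, hw⟩, hle⟩ := hseg i₁ (by omega)
    have hmax : G.IsMaxRank ((Φ i₁).2 ++ [f i₁]) m := by
      refine ⟨⟨f j, hjmem i₁ hji le_rfl, hj₂⟩, ?_⟩
      rintro _ ⟨x, hx, rfl⟩
      obtain ⟨k, hk, rfl⟩ := hle x hx
      exact hN k hk
    have har := arrives_of_switch hσ hj (H i₁) (hf i₁) hci hmax
    have ht := (switch hσ hj (hf i₁) hci).1
    have hph := (htr i₁).1
    change G.Arrives (σ (Φ i₁).1) ((Φ i₁).1.getD v) s m at har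
    change G.Target s t jump (Φ i₁).1 _ at ht
    rw [hw] at har ht hph
    exact hsome w _ m hph ht har

end Composition
end Game

namespace Game

variable {V C : Type*} {player : C → Player} {d : ℕ} {G : Game V player d} {ρ : Strategy V}

/-! ### Positional strategies -/

theorem Step.congr (hp : G.IsPositional ρ) {h h' : List V} {x y : V} (hs : G.Step ρ h x y) :
    G.Step ρ h' x y :=
  ⟨hs.1, fun ho => (hp h' h x (G.adj_mem _ _ hs.1).1 ho).trans (hs.2 ho)⟩

theorem Trace.trans (hp : G.IsPositional ρ) {v x y : V} {h h' : List V} (H : G.Trace ρ v h x)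
    (H' : G.Trace ρ x h' y) : G.Trace ρ v (h ++ h') y := by
  induction H' with
  | nil => simpa using H
  | snoc _ hs ih => rw [← List.append_assoc]; exact ih.snoc (hs.congr hp)

/-- A play from a reached vertex becomes a play from its predecessor by prepending one vertex. The
shifted histories are harmless because `ρ` is positional. -/
theorem IsSafe.of_trace (hp : G.IsPositional ρ) {v x : V} {h : List V} (hv : v ∈ G.verts)
    (hs : G.IsSafe ρ v) (H : G.Trace ρ v h x) : G.IsSafe ρ x := by
  induction H with
  | nil => exact hs
  | @snoc h x y H hst ih =>
    have hx := H.mem_verts hv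
    rw [isSafe_iff hx] at ih
    rw [isSafe_iff (H.snoc hst |>.mem_verts hv)]
    rintro f rfl hf
    have := ih (fun i => Nat.casesOn i x f) rfl fun i => by
      cases i with
      | zero => exact hst.congr hp
      | succ i => exact (hf i).congr hp
    rwa [← wonByE_shift _ 1] at this

/-- Some nonempty sequence of moves from `v` to `y` is consistent with `ρ`, and `r` is the
maximum rank of its vertices before the arrival at `y`. -/
def Leads (G : Game V player d) (ρ : Strategy V) (v : V) (r : Fin d) (y : V) : Prop :=
  ∃ h, G.Trace ρ v h y ∧ G.IsMaxRank h r

theorem Leads.trans (hp : G.IsPositional ρ) {v x y : V} {r r' : Fin d} (H : G.Leads ρ v r x)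
    (H' : G.Leads ρ x r' y) : G.Leads ρ v (max r r') y := by
  obtain ⟨h, H, hr⟩ := H
  obtain ⟨h', H', hr'⟩ := H'
  exact ⟨_, H.trans hp H', hr.append hr'⟩

theorem Leads.arrives (hp : G.IsPositional ρ) {v x : V} {c : C} {r r' : Fin d}
    (hv : v ∈ G.verts) (H : G.Leads ρ v r x) (H' : G.Arrives ρ x c r') :
    G.Arrives ρ v c (max r r') := by
  obtain ⟨h, H, hr⟩ := H
  obtain ⟨h', w, H', hc, hr', hh⟩ := H'
  refine ⟨h ++ h', w, H.trans hp H', hc, ?_, fun ho => ?_⟩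
  · rw [List.append_assoc]; exact hr.append hr'
  · rw [← hh ho]; exact hp _ _ _ ((H.trans hp H').mem_verts hv) ho

theorem Trace.getElem_zero {v x : V} {h : List V} (H : G.Trace ρ v h x) :
    (h ++ [x])[0]'(by simp) = v := by
  have := H.isPath.1
  rw [List.head?_eq_getElem?, List.getElem?_eq_getElem (by simp)] at this
  exact Option.some_injective _ this

theorem Trace.step_getElem {v x : V} {h : List V} (H : G.Trace ρ v h x) (i : ℕ)
    (hi : i < h.length) :
    ∃ h', G.Step ρ h' h[i] ((h ++ [x])[i + 1]'(by simpa using hi)) := by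
  induction H with
  | nil => simp at hi
  | @snoc h x y H hs ih =>
    rcases Nat.lt_or_ge i h.length with hi' | hi'
    · obtain ⟨h', hst⟩ := ih hi'
      refine ⟨h', ?_⟩
      rw [List.getElem_append_left hi', List.getElem_append_left (by simpa using hi')]
      exact hst
    · obtain rfl : i = h.length := by simp at hi; omega
      refine ⟨h, ?_⟩
      simpa using hs

/-- Against a safe positional strategy, the highest rank on a cycle is even. -/
theorem Leads.even_of_cycle (hp : G.IsPositional ρ) {w : V} (hw : w ∈ G.verts)
    (hs : G.IsSafe ρ w) {r : Fin d} (H : G.Leads ρ w r w) : Even (r : ℕ) := by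
  obtain ⟨h, H, hr⟩ := H
  have hn : 0 < h.length := by
    obtain ⟨x, hx, -⟩ := hr.1
    exact List.length_pos_of_mem hx
  have h0 : h[0] = w := by
    have := H.getElem_zero
    rwa [List.getElem_append_left hn] at this
  have hlt : ∀ i, i % h.length < h.length := fun i => Nat.mod_lt _ hn
  -- Going around the cycle forever is a play in which every rank of the cycle recurs.
  let f : ℕ → V := fun i => h[i % h.length]'(hlt i)
  obtain ⟨m, hm, hme⟩ := (isSafe_iff hw).1 hs f (by simpa [f] using h0) fun i => by
    obtain ⟨h', hst⟩ := H.step_getElem (i % h.length) (hlt i)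
    have : f (i + 1) = (h ++ [w])[i % h.length + 1]'(by simpa using hlt i) := by
      have hmod : (i + 1) % h.length = (i % h.length + 1) % h.length := by simp
      rcases (Nat.succ_le_of_lt (hlt i)).lt_or_eq with hi | hi
      · rw [List.getElem_append_left hi]
        simp only [f, hmod, Nat.mod_eq_of_lt hi]
      · have e : (i + 1) % h.length = 0 := by rw [hmod]; simp [← Nat.succ_eq_add_one, hi]
        rw [List.getElem_append_right hi.ge]
        simp [f, e, h0]
    rw [this]
    exact hst.congr hp
  have hrf : IsGreatest {r : Fin d | ∃ᶠ i in Filter.atTop, G.rank (f i) = r} r := by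
    constructor
    · obtain ⟨x, hx, hxr⟩ := hr.1
      obtain ⟨j, hj, rfl⟩ := List.getElem_of_mem hx
      refine Filter.frequently_atTop.2 fun a => ⟨j + h.length * a, ?_, ?_⟩
      · nlinarith
      · simpa [f, Nat.mod_eq_of_lt hj] using hxr
    · intro q hq
      obtain ⟨i, hi⟩ := hq.exists
      exact hr.2 ⟨_, List.getElem_mem _, hi⟩
  rwa [hrf.unique hm]

/-! ### Restriction of a strategy to a game with fewer edges -/

open Classical in
/-- The strategy that stops where `ρ` would use an edge that is not in `G`. -/
noncomputable def restrict (G : Game V player d) (ρ : Strategy V) : Strategy V := fun h x =>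
  match ρ h x with
  | .halt => .halt
  | .go y => if G.adj x y then .go y else .halt

theorem restrict_go {h : List V} {x y : V} (H : G.restrict ρ h x = .go y) :
    ρ h x = .go y ∧ G.adj x y := by
  unfold restrict at H
  split at H
  · cases H
  · next z hz =>
    split_ifs at H with ha
    cases H
    exact ⟨hz, ha⟩

theorem restrict_halt {h : List V} {x : V} (H : G.restrict ρ h x = .halt) :
    ρ h x = .halt ∨ ∃ y, ρ h x = .go y ∧ ¬ G.adj x y := by
  unfold restrict at H
  split at H
  · next hz => exact Or.inl hz
  · next z hz =>
    split_ifs at H with ha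
    exact Or.inr ⟨z, hz, ha⟩

theorem restrict_isStrategy : G.IsStrategy (G.restrict ρ) :=
  fun _ _ _ _ _ H => (restrict_go H).2

section AddEdges

variable {s t : C}

theorem restrict_isPositional (hp : (G.addEdges s t).IsPositional ρ) :
    G.IsPositional (G.restrict ρ) := by
  intro h h' x hx ho
  unfold restrict
  rw [hp h h' x hx ho]

theorem Step.of_restrict {h : List V} {x y : V} (H : G.Step (G.restrict ρ) h x y) :
    (G.addEdges s t).Step ρ h x y :=
  ⟨Or.inl H.1, fun ho => (restrict_go (H.2 ho)).1⟩

theorem Trace.of_restrict {v : V} {h : List V} {x : V} (H : G.Trace (G.restrict ρ) v h x) :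
    (G.addEdges s t).Trace ρ v h x := by
  induction H with
  | nil => exact .nil
  | snoc _ hs ih => exact ih.snoc hs.of_restrict

theorem IsSafe.restrict {v : V} (hv : v ∈ G.verts) (hs : (G.addEdges s t).IsSafe ρ v) :
    G.IsSafe (G.restrict ρ) v := by
  rw [isSafe_iff hv]
  intro f h0 hf
  exact (isSafe_iff (G := G.addEdges s t) hv).1 hs f h0 fun i => (hf i).of_restrict

/-- A stop of the restricted strategy is a genuine stop, or it hides a new edge, which starts at a
vertex of `E` with color `s`. The rank `r` is then that of the path up to this edge, as `Leads`
counts it. -/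
theorem Arrives.of_restrict (hρ : (G.addEdges s t).IsStrategy ρ) {v : V} (hv : v ∈ G.verts)
    {c : C} {r : Fin d} (H : G.Arrives (G.restrict ρ) v c r) :
    (G.addEdges s t).Arrives ρ v c r ∨ (c = s ∧ player s = .E ∧
      ∃ y ∈ G.verts, G.color y = t ∧ (G.addEdges s t).Leads ρ v r y) := by
  obtain ⟨h, x, H, hc, hr, hh⟩ := H
  by_cases hst : G.owner x = .E → ρ h x = .halt
  · exact Or.inl ⟨h, x, H.of_restrict, hc, hr, hst⟩
  · push Not at hst
    obtain ⟨ho, hn⟩ := hst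
    obtain ⟨y, hy, hny⟩ := (restrict_halt (hh ho)).resolve_left hn
    have hx := H.mem_verts hv
    have ha := hρ h x y hx ho hy
    obtain ⟨-, hyv, hxs, hyt⟩ := ha.resolve_left hny
    refine Or.inr ⟨hc.symm.trans hxs, ?_, y, hyv, hyt, h ++ [x],
      H.of_restrict.snoc ⟨ha, fun _ => hy⟩, hr⟩
    rw [← hxs, G.player_color x hx, ho]

/-! ### Strategies that are not affected by the new edges -/

theorem Step.of_addEdges (hρ : G.IsStrategy ρ) {h : List V} {x y : V}
    (hx : G.color x = s → G.owner x = .E) (H : (G.addEdges s t).Step ρ h x y) :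
    G.Step ρ h x y := by
  refine ⟨?_, H.2⟩
  rcases H.1 with ha | ⟨hxv, -, hxs, -⟩
  · exact ha
  · exact hρ _ _ _ hxv (hx hxs) (H.2 (hx hxs))

theorem Trace.of_addEdges (hρ : G.IsStrategy ρ) {v : V}
    (hE : ∀ h x, G.Trace ρ v h x → G.color x = s → G.owner x = .E) {h : List V} {x : V}
    (H : (G.addEdges s t).Trace ρ v h x) : G.Trace ρ v h x := by
  induction H with
  | nil => exact .nil
  | snoc _ hs ih => exact ih.snoc (hs.of_addEdges hρ (hE _ _ ih))

/-- If every reached vertex of color `s` belongs to `E`, the old strategy never takes a new edge and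
`O` cannot, so the same strategy works. -/
theorem exists_addEdges_of_unaffected (hρ : G.IsStrategy ρ) {v : V} (hv : v ∈ G.verts)
    (hs : G.IsSafe ρ v) (hE : ∀ h x, G.Trace ρ v h x → G.color x = s → G.owner x = .E)
    {P : Enforcement C d} (hP : (G.enforcement ρ v).Le P) :
    ∃ ρ : Strategy V, (G.addEdges s t).IsStrategy ρ ∧ (G.addEdges s t).IsSafe ρ v ∧
      ((G.addEdges s t).enforcement ρ v).Le P := by
  refine ⟨ρ, fun h x y hx ho hy => Or.inl (hρ h x y hx ho hy), ?_, enforcement_le ?_⟩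
  · rw [isSafe_iff (G := G.addEdges s t) hv]
    intro f h0 hf
    exact (isSafe_iff hv).1 hs f h0 fun i =>
      (hf i).of_addEdges hρ (hE _ _ ((trace_of_infinite h0 hf i).of_addEdges hρ hE))
  · rintro c r ⟨h, x, H, hx⟩
    exact Arrives.of_enforcement_le hρ hv hP ⟨h, x, H.of_addEdges hρ hE, hx⟩

end AddEdges

end Game

/-! ### Evaluation of circuits -/

namespace Circuit

variable {ι : Type*} (b : ι → Bool)

@[simp] theorem eval_input (i : ι) : (input i).eval b = b i := rfl

@[simp] theorem eval_const (a : Bool) : (const a : Circuit ι).eval b = a := rfl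

@[simp] theorem eval_not (g : Circuit ι) : (not g).eval b = !(g.eval b) := rfl

@[simp] theorem eval_and (g h : Circuit ι) :
    (g.and h).eval b = true ↔ g.eval b = true ∧ h.eval b = true := by
  simp [Circuit.and, eval, Fin.forall_fin_two]

@[simp] theorem eval_or (g h : Circuit ι) :
    (g.or h).eval b = true ↔ g.eval b = true ∨ h.eval b = true := by
  simp [Circuit.or, eval, Fin.exists_fin_two]

@[simp] theorem eval_bigAnd {α : Type*} [Finite α] (g : α → Circuit ι) :
    (bigAnd g).eval b = true ↔ ∀ a, (g a).eval b = true := by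
  simp only [bigAnd, eval, decide_eq_true_eq]
  exact (Finite.equivFin α).symm.forall_congr_right (q := fun a => (g a).eval b = true)

@[simp] theorem eval_bigOr {α : Type*} [Finite α] (g : α → Circuit ι) :
    (bigOr g).eval b = true ↔ ∃ a, (g a).eval b = true := by
  simp only [bigOr, eval, decide_eq_true_eq]
  exact (Finite.equivFin α).symm.exists_congr_right (q := fun a => (g a).eval b = true)

end Circuit

namespace Game

variable {V C : Type*} {player : C → Player} {d : ℕ}

/-! ### The output sets of the gadget -/

section Output

variable (G : Game V player d) (s t : C) (F : V → Set (Enforcement C d))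

/-- The enforcements available right after a move to a vertex of color `t`. -/
def Opt (R : Enforcement C d) : Prop :=
  (∃ w ∈ G.verts, G.color w = t ∧ R ∈ F w) ∨
    (R s = none ∧ ∃ r : Fin d, Even (r : ℕ) ∧
      ∃ w ∈ G.verts, G.color w = t ∧ R.set s (some r) ∈ F w)

/-- The output set for the case where `s` is a color of player `E`. -/
def outE (v : V) : Set (Enforcement C d) :=
  {P | (∃ S ∈ F v, S.Le P) ∨ ∃ Q R, Q ∈ F v ∧ (Q.merge .E s R).Le P ∧ G.Opt s t F R}

/-- The output set for the case where `s` is a color of player `O`. -/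
def outO (v : V) : Set (Enforcement C d) :=
  {P | ∃ Q ∈ F v, Q.Le P ∧ (Q s = none ∨ ∀ w ∈ G.verts, G.color w = t →
    ∃ R ∈ F w, (∀ r : Fin d, R s = some r → Even (r : ℕ)) ∧ (Q.merge .O s R).Le P)}

variable {G s t F} {v : V}

theorem outE_upClosed {P P' : Enforcement C d} (hP : P ∈ G.outE s t F v) (h : P.Le P') :
    P' ∈ G.outE s t F v := by
  rcases hP with ⟨S, hS, hSP⟩ | ⟨Q, R, hQ, hm, hR⟩
  · exact Or.inl ⟨S, hS, hSP.trans h⟩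
  · exact Or.inr ⟨Q, R, hQ, hm.trans h, hR⟩

theorem outO_upClosed {P P' : Enforcement C d} (hP : P ∈ G.outO s t F v) (h : P.Le P') :
    P' ∈ G.outO s t F v := by
  obtain ⟨Q, hQ, hQP, hR⟩ := hP
  refine ⟨Q, hQ, hQP.trans h, hR.imp_right fun hR w hw hwt => ?_⟩
  obtain ⟨R, hR, he, hm⟩ := hR w hw hwt
  exact ⟨R, hR, he, hm.trans h⟩

/-! ### Soundness of the output sets -/

theorem unaffected_of_player_E (hv : v ∈ G.verts) (hE : player s = .E) {ρ : Strategy V} (h : List V)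
    (x : V) (H : G.Trace ρ v h x) (hx : G.color x = s) : G.owner x = .E := by
  rw [← G.player_color x (H.mem_verts hv), hx, hE]

/-- A vertex from which player `E` can continue after an arrival at `s`, with a strategy for this
and the information whether the arrivals at `s` are used for returning to this vertex. -/
theorem Opt.exists_strategy (hF : ∀ w ∈ G.verts, G.Valid w (F w)) {R : Enforcement C d}
    (hR : G.Opt s t F R) : ∃ w ∈ G.verts, G.color w = t ∧ ∃ ρ, G.IsStrategy ρ ∧ G.IsSafe ρ w ∧
      ∃ loop : Bool, (∀ c r, G.Arrives ρ w c r → (c = s → loop = false) →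
          ∃ p, R c = some p ∧ PrecEq p r) ∧
        (loop = true → ∀ r, G.Arrives ρ w s r → Even (r : ℕ)) := by
  rcases hR with ⟨w, hw, hwt, hR⟩ | ⟨hRs, r, hr, w, hw, hwt, hR⟩
  · obtain ⟨ρ, hρ, hs, hle⟩ := (hF w hw).sound R hR
    exact ⟨w, hw, hwt, ρ, hρ, hs, false, fun c r h _ => h.of_enforcement_le hρ hw hle,
      fun h => by cases h⟩
  · obtain ⟨ρ, hρ, hs, hle⟩ := (hF w hw).sound _ hR
    refine ⟨w, hw, hwt, ρ, hρ, hs, true, fun c r' h hc => ?_, fun _ r' h => ?_⟩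
    · have hcs : c ≠ s := fun e => by cases hc e
      obtain ⟨p, hp, hpr⟩ := h.of_enforcement_le hρ hw hle
      exact ⟨p, by simpa [Enforcement.set, hcs] using hp, hpr⟩
    · obtain ⟨p, hp, hpr⟩ := h.of_enforcement_le hρ hw hle
      obtain rfl : r = p := by simpa [Enforcement.set] using hp
      exact hpr.even hr

theorem outE_sound (hF : ∀ w ∈ G.verts, G.Valid w (F w)) (hE : player s = .E) (hv : v ∈ G.verts)
    {P : Enforcement C d} (hP : P ∈ G.outE s t F v) :
    ∃ ρ : Strategy V, (G.addEdges s t).IsStrategy ρ ∧ (G.addEdges s t).IsSafe ρ v ∧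
      ((G.addEdges s t).enforcement ρ v).Le P := by
  have hdirect : ∀ S ∈ F v, S.Le P → ∃ ρ : Strategy V, (G.addEdges s t).IsStrategy ρ ∧
      (G.addEdges s t).IsSafe ρ v ∧ ((G.addEdges s t).enforcement ρ v).Le P := by
    intro S hS hSP
    obtain ⟨ρ, hρ, hs, hle⟩ := (hF v hv).sound S hS
    exact exists_addEdges_of_unaffected hρ hv hs (unaffected_of_player_E hv hE) (hle.trans hSP)
  rcases hP with ⟨S, hS, hSP⟩ | ⟨Q, R, hQ, hm, hR⟩
  · exact hdirect S hS hSP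
  cases hQs : Q s with
  | none =>
    rw [Enforcement.merge_none hQs] at hm
    exact hdirect Q hQ hm
  | some q =>
    rw [Enforcement.merge_E hQs, Enforcement.union_le_iff, Enforcement.set_none_le_iff,
      Enforcement.lift_le_iff] at hm
    obtain ⟨ρ₁, hρ₁, hs₁, hle₁⟩ := (hF v hv).sound Q hQ
    obtain ⟨w, hw, hwt, ρ₂, hρ₂, hs₂, loop, harr, hloop⟩ := hR.exists_strategy hF
    let σ : Option V → Strategy V := fun φ => φ.elim ρ₁ fun _ => ρ₂
    -- The first phase always jumps at `s`. Later phases jump back to the same `w` exactly if `R`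
    -- comes from `LOOPED`; otherwise their stops at `s` are kept and bounded by `R`.
    let jump : Option V → Option V := fun φ =>
      φ.elim (some w) fun _ => bif loop then some w else none
    have hσ : ∀ φ, G.IsStrategy (σ φ) := by
      rintro (_ | _) <;> assumption
    have hjw : ∀ φ w', jump φ = some w' → w' = w := by
      rintro (_ | _) w' h
      · exact (Option.some_injective _ h).symm
      · cases loop
        · cases h
        · exact (Option.some_injective _ h).symm
    have hj : ∀ φ w', jump φ = some w' → w' ∈ G.verts ∧ G.color w' = t := by
      intro φ w' h
      obtain rfl := hjw _ _ h
      exact ⟨hw, hwt⟩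
    have hphase : ∀ w', G.IsPhase s t jump (some w') → w' = w := by
      intro w' h
      obtain ⟨φ, -, -, h⟩ := h w' rfl
      exact hjw φ w' (h hE)
    have hnone : ∀ y r, G.Target s t jump none y → G.Arrives (σ none) v s r → PrecEq q r := by
      intro _ r _ h
      obtain ⟨p, hp, hpr⟩ := h.of_enforcement_le hρ₁ hv hle₁
      obtain rfl : q = p := Option.some_injective _ (hQs.symm.trans hp)
      exact hpr
    have hsome : ∀ w y r, G.IsPhase s t jump (some w) → G.Target s t jump (some w) y →
        G.Arrives (σ (some w)) w s r → Even (r : ℕ) := by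
      intro w' y r hw' hy h
      obtain rfl := hphase w' hw'
      have := hy.2.2 hE
      refine hloop ?_ r h
      cases loop
      · cases this
      · rfl
    refine ⟨G.compose s σ jump, compose_isStrategy hσ hj,
      compose_isSafe hσ hj hv hsome ?_, enforcement_le ?_⟩
    · rintro (_ | w') hw'
      · exact hs₁
      · obtain rfl := hphase w' hw'
        exact hs₂
    · intro c r h
      rcases compose_arrives hσ hj hv hnone hsome h with ⟨hc, h⟩ | ⟨w', r', A, hw', hc, h', hA, hr⟩
      · have hcs : c ≠ s := fun e => by cases hc e hE
        obtain ⟨p, hp, hpr⟩ := h.of_enforcement_le hρ₁ hv hle₁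
        obtain ⟨p', hp', hpp⟩ := hm.1 c p hcs hp
        exact ⟨p', hp', hpp.trans hpr⟩
      · obtain rfl := hphase w' hw'
        obtain ⟨p, hp, hpr⟩ := harr c r' h' fun e => by
          have := hc e hE
          cases loop
          · rfl
          · cases this
        obtain ⟨p', hp', hpp⟩ := hm.2 c p hp
        exact ⟨p', hp', hpp.trans (hr ▸ hA.max hpr)⟩

theorem outO_sound (hF : ∀ w ∈ G.verts, G.Valid w (F w)) (hv : v ∈ G.verts)
    (hO : player s = .O) {P : Enforcement C d} (hP : P ∈ G.outO s t F v) :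
    ∃ ρ : Strategy V, (G.addEdges s t).IsStrategy ρ ∧ (G.addEdges s t).IsSafe ρ v ∧
      ((G.addEdges s t).enforcement ρ v).Le P := by
  obtain ⟨Q, hQ, hQP, hR⟩ := hP
  obtain ⟨ρ₁, hρ₁, hs₁, hle₁⟩ := (hF v hv).sound Q hQ
  have howner : ∀ x ∈ G.verts, G.color x = s → G.owner x = .E → False := by
    intro x hx hxs ho
    rw [← G.player_color x hx, hxs, hO] at ho
    cases ho
  cases hQs : Q s with
  | none =>
    -- Every visit to a vertex of `O` counts as an arrival. As `Q` is undefined at `s`, no vertex of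
    -- color `s` is ever reached.
    refine exists_addEdges_of_unaffected hρ₁ hv hs₁ (fun h x H hx => ?_) (hle₁.trans hQP)
    obtain ⟨r, hr⟩ := G.exists_isMaxRank (p := h ++ [x]) (by simp)
    obtain ⟨p, hp, -⟩ := Arrives.of_enforcement_le hρ₁ hv hle₁
      ⟨h, x, H, hx, hr, fun ho => (howner x (H.mem_verts hv) hx ho).elim⟩
    rw [hQs] at hp
    cases hp
  | some q =>
    replace hR := hR.resolve_left (by simp [hQs])
    have hR' : ∀ w, ∃ ρ, G.IsStrategy ρ ∧ (w ∈ G.verts → G.color w = t → G.IsSafe ρ w ∧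
        (∀ r, G.Arrives ρ w s r → Even (r : ℕ)) ∧ ∀ c r A, PrecEq q A → G.Arrives ρ w c r →
          ∃ p, P c = some p ∧ PrecEq p (max A r)) := by
      intro w
      by_cases hw : w ∈ G.verts ∧ G.color w = t
      · obtain ⟨R, hR, he, hm⟩ := hR w hw.1 hw.2
        obtain ⟨ρ, hρ, hs, hle⟩ := (hF w hw.1).sound R hR
        rw [Enforcement.merge_O hQs, Enforcement.union_le_iff, Enforcement.lift_le_iff] at hm
        refine ⟨ρ, hρ, fun _ _ => ⟨hs, fun r h => ?_, fun c r A hA h => ?_⟩⟩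
        · obtain ⟨p, hp, hpr⟩ := h.of_enforcement_le hρ hw.1 hle
          exact hpr.even (he p hp)
        · obtain ⟨p, hp, hpr⟩ := h.of_enforcement_le hρ hw.1 hle
          obtain ⟨p', hp', hpp⟩ := hm.2 c p hp
          exact ⟨p', hp', hpp.trans (hA.max hpr)⟩
      -- A dummy strategy for vertices at which no phase can start.
      · exact ⟨fun _ _ => .halt, (fun _ _ _ _ _ h => by cases h),
          fun h₁ h₂ => absurd ⟨h₁, h₂⟩ hw⟩
    choose ρ₂ hρ₂ hR' using hR'
    let σ : Option V → Strategy V := fun φ => φ.elim ρ₁ ρ₂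
    -- Switches are moves of `O` here; `E` never jumps.
    let jump : Option V → Option V := fun _ => none
    have hσ : ∀ φ, G.IsStrategy (σ φ) := by
      rintro (_ | w)
      · exact hρ₁
      · exact hρ₂ w
    have hj : ∀ φ w', jump φ = some w' → w' ∈ G.verts ∧ G.color w' = t := by
      intro φ w' h
      cases h
    have hphase : ∀ w, G.IsPhase s t jump (some w) → w ∈ G.verts ∧ G.color w = t := by
      intro w h
      obtain ⟨_, h₁, h₂, -⟩ := h w rfl
      exact ⟨h₁, h₂⟩
    have hnone : ∀ y r, G.Target s t jump none y → G.Arrives (σ none) v s r → PrecEq q r := by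
      intro _ r _ h
      obtain ⟨p, hp, hpr⟩ := h.of_enforcement_le hρ₁ hv hle₁
      obtain rfl : q = p := Option.some_injective _ (hQs.symm.trans hp)
      exact hpr
    have hsome : ∀ w y r, G.IsPhase s t jump (some w) → G.Target s t jump (some w) y →
        G.Arrives (σ (some w)) w s r → Even (r : ℕ) := by
      intro w y r hw _ h
      exact (hR' w (hphase w hw).1 (hphase w hw).2).2.1 r h
    refine ⟨G.compose s σ jump, compose_isStrategy hσ hj,
      compose_isSafe hσ hj hv hsome ?_, enforcement_le ?_⟩
    · rintro (_ | w) hw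
      · exact hs₁
      · exact (hR' w (hphase w hw).1 (hphase w hw).2).1
    · intro c r h
      rcases compose_arrives hσ hj hv hnone hsome h with ⟨-, h⟩ | ⟨w, r', A, hw, -, h, hA, hr⟩
      · exact h.of_enforcement_le hρ₁ hv (hle₁.trans hQP)
      · rw [hr]
        exact (hR' w (hphase w hw).1 (hphase w hw).2).2.2 c r' A hA h

/-! ### Completeness of the output sets -/

theorem outO_complete (hF : ∀ w ∈ G.verts, G.Valid w (F w)) (hv : v ∈ G.verts)
    (hO : player s = .O) {ρ : Strategy V} (hρ : (G.addEdges s t).IsStrategy ρ)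
    (hp : (G.addEdges s t).IsPositional ρ) (hs : (G.addEdges s t).IsSafe ρ v) :
    (G.addEdges s t).enforcement ρ v ∈ G.outO s t F v := by
  have hv' : v ∈ (G.addEdges s t).verts := hv
  have hres : ∀ w ∈ G.verts, ∀ c r, G.Arrives (G.restrict ρ) w c r →
      (G.addEdges s t).Arrives ρ w c r := by
    intro w hw c r h
    refine (h.of_restrict hρ hw).resolve_right fun h => ?_
    rw [hO] at h
    cases h.2.1
  -- From any vertex of color `s`, `O` may use the new edge to every `w` of color `t`.
  have hlead : ∀ u ∈ G.verts, ∀ w ∈ G.verts, G.color w = t → ∀ r,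
      (G.addEdges s t).Arrives ρ u s r → (G.addEdges s t).Leads ρ u r w := by
    rintro u hu w hw hwt r ⟨h, x, H, hx, hr, -⟩
    have hxv : x ∈ G.verts := H.mem_verts hu
    refine ⟨h ++ [x], H.snoc ⟨Or.inr ⟨hxv, hw, hx, hwt⟩, fun ho => ?_⟩, hr⟩
    change G.color x = s at hx
    change G.owner x = .E at ho
    rw [← G.player_color x hxv, hx, hO] at ho
    cases ho
  have hmem : ∀ w ∈ G.verts, (G.addEdges s t).IsSafe ρ w →
      G.enforcement (G.restrict ρ) w ∈ F w := fun w hw hsw =>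
    (hF w hw).complete _ restrict_isStrategy (restrict_isPositional hp) (hsw.restrict hw)
  have hle : (G.enforcement (G.restrict ρ) v).Le ((G.addEdges s t).enforcement ρ v) :=
    enforcement_le fun c r h => (hres v hv c r h).enforcement hρ hv
  refine ⟨_, hmem v hv hs, hle, ?_⟩
  cases hQs : G.enforcement (G.restrict ρ) v s with
  | none => exact Or.inl rfl
  | some q =>
    refine Or.inr fun w hw hwt => ?_
    have hvw := hlead v hv w hw hwt q (hres v hv s q (arrives_of_enforcement hQs))
    have hsw : (G.addEdges s t).IsSafe ρ w := by
      obtain ⟨h, H, -⟩ := hvw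
      exact hs.of_trace hp hv' H
    refine ⟨_, hmem w hw hsw, fun r hr => ?_, ?_⟩
    -- An arrival at `s` from `w` can be followed by the new edge back to `w`, which closes a cycle.
    · exact (hlead w hw w hw hwt r (hres w hw s r (arrives_of_enforcement hr))).even_of_cycle
        hp hw hsw
    · rw [Enforcement.merge_O hQs, Enforcement.union_le_iff, Enforcement.lift_le_iff]
      refine ⟨hle, fun c r hr => ?_⟩
      rw [← Fin.coe_max']
      exact (hvw.arrives hp hv' (hres w hw c r (arrives_of_enforcement hr))).enforcement hρ hv

theorem outE_complete [Finite V] (hF : ∀ w ∈ G.verts, G.Valid w (F w)) (hv : v ∈ G.verts)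
    {ρ : Strategy V} (hρ : (G.addEdges s t).IsStrategy ρ)
    (hp : (G.addEdges s t).IsPositional ρ) (hs : (G.addEdges s t).IsSafe ρ v) :
    (G.addEdges s t).enforcement ρ v ∈ G.outE s t F v := by
  have hv' : v ∈ (G.addEdges s t).verts := hv
  have hmem : ∀ w ∈ G.verts, (G.addEdges s t).IsSafe ρ w →
      G.enforcement (G.restrict ρ) w ∈ F w := fun w hw hsw =>
    (hF w hw).complete _ restrict_isStrategy (restrict_isPositional hp) (hsw.restrict hw)
  have hne : ∀ w ∈ G.verts, ∀ c r, c ≠ s → G.Arrives (G.restrict ρ) w c r →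
      (G.addEdges s t).Arrives ρ w c r := fun w hw c r hc h =>
    (h.of_restrict hρ hw).resolve_right fun h => hc h.1
  -- If the worst arrival at `s` is a genuine stop of `ρ`, jumps elsewhere do not matter: the
  -- restricted enforcement is already `⊑` the full one.
  have hdirect : (∀ q, G.enforcement (G.restrict ρ) v s = some q →
      (G.addEdges s t).Arrives ρ v s q) → (G.addEdges s t).enforcement ρ v ∈ G.outE s t F v := by
    intro hq
    refine Or.inl ⟨_, hmem v hv hs, fun c r hr => ?_⟩
    by_cases hc : c = s
    · subst hc
      exact (hq r hr).enforcement hρ hv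
    · exact (hne v hv c r hc (arrives_of_enforcement hr)).enforcement hρ hv
  cases hQs : G.enforcement (G.restrict ρ) v s with
  | none => exact hdirect fun q hq => by rw [hQs] at hq; cases hq
  | some q =>
    rcases (arrives_of_enforcement hQs).of_restrict hρ hv with ha | ⟨-, -, w₀, hw₀, hwt₀, hl₀⟩
    · refine hdirect fun q' hq' => ?_
      obtain rfl : q = q' := Option.some_injective _ (hQs.symm.trans hq')
      exact ha
    -- Any member of `A` may serve as the target for the merge: reaching it is at least as bad for
    -- `E` as the arrival `q` that is recorded at `s`.
    let A : Set V := {w | w ∈ G.verts ∧ G.color w = t ∧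
      ∃ r : Fin d, (G.addEdges s t).Leads ρ v r w ∧ PrecEq r q}
    have hAsafe : ∀ w ∈ A, (G.addEdges s t).IsSafe ρ w := by
      rintro w ⟨-, -, r, ⟨h, H, -⟩, -⟩
      exact hs.of_trace hp hv' H
    let T : A → A → Prop := fun w' w => ∃ r : Fin d, Odd (r : ℕ) ∧ (G.addEdges s t).Leads ρ w r w'
    have : IsTrans A T := ⟨by
      rintro w₃ w₂ w₁ ⟨r, hr, h⟩ ⟨r', hr', h'⟩
      refine ⟨max r' r, ?_, h'.trans hp h⟩
      rcases le_total r' r with e | e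
      · rwa [max_eq_right e]
      · rwa [max_eq_left e]⟩
    have : Std.Irrefl T := ⟨by
      rintro ⟨w, hw⟩ ⟨r, hr, h⟩
      exact (Nat.not_even_iff_odd.2 hr) (h.even_of_cycle hp hw.1 (hAsafe w hw))⟩
    obtain ⟨⟨w, hw⟩, -, hmin⟩ := (Finite.wellFounded_of_trans_of_irrefl T).has_min Set.univ
      ⟨⟨w₀, hw₀, hwt₀, q, hl₀, .refl _⟩, trivial⟩
    have hwv := hw.1
    have hwt := hw.2.1
    obtain ⟨r₁, hl, hr₁⟩ := hw.2.2
    obtain ⟨R, hR, hRarr⟩ : ∃ R, G.Opt s t F R ∧ ∀ c r, R c = some r →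
        (G.addEdges s t).Arrives ρ w c r := by
      have hin := hmem w hwv (hAsafe w hw)
      by_cases hst : ∀ r, G.enforcement (G.restrict ρ) w s = some r →
          (G.addEdges s t).Arrives ρ w s r
      · refine ⟨_, Or.inl ⟨w, hwv, hwt, hin⟩, fun c r hr => ?_⟩
        by_cases hc : c = s
        · subst hc
          exact hst r hr
        · exact hne w hwv c r hc (arrives_of_enforcement hr)
      · push Not at hst
        obtain ⟨r, hr, hn⟩ := hst
        obtain ⟨-, -, y, hy, hyt, hly⟩ :=
          ((arrives_of_enforcement hr).of_restrict hρ hwv).resolve_left hn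
        have he : Even (r : ℕ) := by
          by_contra ho
          rw [Nat.not_even_iff_odd] at ho
          -- With `r` odd, `y` would again belong to `A`, since an odd rank only lowers the rank of
          -- the way from `v`, and it would lie below `w` for `T`.
          refine hmin ⟨y, hy, hyt, max r₁ r, hl.trans hp hly, ?_⟩ trivial ⟨r, ho, hly⟩
          rw [Fin.coe_max']
          exact hr₁.max_odd ho
        -- The worst arrival at `s` is hidden by a jump, so it is erased from `R`; restoring the
        -- even value `r` gives the input enforcement back, as `LOOPED` requires.
        refine ⟨(G.enforcement (G.restrict ρ) w).set s none,
          Or.inr ⟨by simp [Enforcement.set], r, he, w, hwv, hwt, ?_⟩, fun c r' hr' => ?_⟩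
        · have : ((G.enforcement (G.restrict ρ) w).set s none).set s (some r) =
              G.enforcement (G.restrict ρ) w := by
            simp [Enforcement.set, ← hr]
          rwa [this]
        · have hc : c ≠ s := by
            rintro rfl
            simp [Enforcement.set] at hr'
          exact hne w hwv c r' hc
            (arrives_of_enforcement (by simpa [Enforcement.set, hc] using hr'))
    refine Or.inr ⟨_, R, hmem v hv hs, ?_, hR⟩
    rw [Enforcement.merge_E hQs, Enforcement.union_le_iff, Enforcement.set_none_le_iff,
      Enforcement.lift_le_iff]
    refine ⟨fun c r hc hr => (hne v hv c r hc (arrives_of_enforcement hr)).enforcement hρ hv,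
      fun c r hr => ?_⟩
    obtain ⟨p, hp', hpr⟩ := (hl.arrives hp hv' (hRarr c r hr)).enforcement hρ hv
    rw [Fin.coe_max'] at hpr
    exact ⟨p, hp', hpr.trans (hr₁.max (.refl _))⟩

end Output

end Game

/-! ### The circuit computes the output sets -/

namespace UpdateGadget

variable {V C : Type*} {d : ℕ} {player : C → Player} {G : Game V player d}
  {s t : C} {b : InputBit V C d → Bool}

theorem eval_move [Finite V] (hused : ∀ v : V, b (.used v) = true ↔ v ∈ G.verts)
    (hcolor : ∀ v ∈ G.verts, ∀ c : C, b (.color v c) = true ↔ G.color v = c)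
    (P : Enforcement C d) : (move t P).eval b = true ↔
      ∃ w ∈ G.verts, G.color w = t ∧ b (.enf w P) = true := by
  simp only [move, Circuit.eval_bigOr, Circuit.eval_and, Circuit.eval_input, hused]
  refine exists_congr fun w => and_congr_right fun hw => ?_
  rw [hcolor w hw]

theorem eval_opt [Finite V] (hused : ∀ v : V, b (.used v) = true ↔ v ∈ G.verts)
    (hcolor : ∀ v ∈ G.verts, ∀ c : C, b (.color v c) = true ↔ G.color v = c)
    (P : Enforcement C d) : (opt s t P).eval b = true ↔
      G.Opt s t (fun w => {P | b (.enf w P) = true}) P := by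
  simp [opt, looped, Game.Opt, eval_move hused hcolor]

theorem eval_updateE [Finite V] [Finite C] (hused : ∀ v : V, b (.used v) = true ↔ v ∈ G.verts)
    (hcolor : ∀ v ∈ G.verts, ∀ c : C, b (.color v c) = true ↔ G.color v = c)
    {v : V} (hv : v ∈ G.verts) (P : Enforcement C d) : (updateE s t v P).eval b = true ↔
      P ∈ G.outE s t (fun w => {P | b (.enf w P) = true}) v := by
  simp only [updateE, Circuit.eval_and, Circuit.eval_or, Circuit.eval_bigOr, Circuit.eval_input,
    eval_opt hused hcolor, hused, hv, true_and, Game.outE, Set.mem_ofPred_eq, Subtype.exists,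
    Prod.exists, exists_prop]
  refine or_congr (exists_congr fun S => and_comm) (exists_congr fun Q => exists_congr fun R => ?_)
  exact and_left_comm

theorem eval_updateO [Finite V] [Finite C] (hused : ∀ v : V, b (.used v) = true ↔ v ∈ G.verts)
    (hcolor : ∀ v ∈ G.verts, ∀ c : C, b (.color v c) = true ↔ G.color v = c)
    {v : V} (hv : v ∈ G.verts) (P : Enforcement C d) : (updateO s t v P).eval b = true ↔
      P ∈ G.outO s t (fun w => {P | b (.enf w P) = true}) v := by
  have hgood : ∀ Q w, (anyGoodAt s t Q P w).eval b = true ↔ (w ∈ G.verts → G.color w = t →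
      ∃ R ∈ {P | b (.enf w P) = true}, (∀ r : Fin d, R s = some r → Even (r : ℕ)) ∧
        (Q.merge .O s R).Le P) := by
    intro Q w
    simp only [anyGoodAt, Circuit.eval_or, Circuit.eval_not, Circuit.eval_bigOr,
      Circuit.eval_input, Bool.not_eq_true', Bool.eq_false_iff, ne_eq, hused, Subtype.exists,
      exists_prop, Set.mem_ofPred_eq, ← imp_iff_not_or]
    refine imp_congr_right fun hw => ?_
    rw [hcolor w hw]
    exact imp_congr_right fun _ => exists_congr fun R => and_comm
  simp only [updateO, anyGood, Circuit.eval_and, Circuit.eval_or, Circuit.eval_bigOr,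
    Circuit.eval_bigAnd, Circuit.eval_input, Circuit.eval_const, Option.isNone_iff_eq_none,
    hgood, hused, hv, true_and, Game.outO, Set.mem_ofPred_eq, Subtype.exists, exists_prop]
  exact exists_congr fun Q => and_left_comm

theorem eval_update [Finite V] [Finite C] (v : V) (P : Enforcement C d) :
    (update s t v P).eval b = true ↔
    ((updateE s t v P).eval b = true ∧ b .ecolor = true) ∨
      ((updateO s t v P).eval b = true ∧ ¬ b .ecolor = true) := by
  simp [update, Circuit.choose, Circuit.eval, Fin.exists_fin_two]

end UpdateGadget

theorem mainTheorem4 {V C : Type*} [Finite V] [Finite C] {d : ℕ} (player : C → Player)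
    (G G' : Game V player d) (hsub : G'.IsSubgame G) (s t : C)
    (b : InputBit V C d → Bool)
    (hecolor : b .ecolor = true ↔ player s = .E)
    (hused : ∀ v : V, b (.used v) = true ↔ v ∈ G'.verts)
    (hcolor : ∀ v ∈ G.verts, ∀ c : C, b (.color v c) = true ↔ G.color v = c)
    (hvalid : ∀ v ∈ G'.verts, G'.Valid v {P | b (.enf v P) = true}) :
    ∀ v ∈ G'.verts,
      (G'.addEdges s t).Valid v {P | (UpdateGadget.update s t v P).eval b = true} := by
  intro v hv
  have hcolor' : ∀ v ∈ G'.verts, ∀ c : C, b (.color v c) = true ↔ G'.color v = c := by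
    intro v hv c
    rw [hcolor v (hsub.verts_subset hv), hsub.color_eq v hv]
  simp only [UpdateGadget.eval_update, UpdateGadget.eval_updateE hused hcolor' hv,
    UpdateGadget.eval_updateO hused hcolor' hv, hecolor]
  cases hs : player s with
  | E =>
    simp only [and_true, not_true_eq_false, and_false, or_false]
    exact ⟨fun P hP => Game.outE_sound hvalid hs hv hP,
      fun ρ hρ hp hsafe => Game.outE_complete hvalid hv hρ hp hsafe,
      fun P hP Q hPQ => by
        rw [Set.mem_ofPred_eq] at hP ⊢
        exact Game.outE_upClosed hP hPQ⟩
  | O =>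
    simp only [reduceCtorEq, and_false, not_false_eq_true, and_true, false_or]
    exact ⟨fun P hP => Game.outO_sound hvalid hv hs hP,
      fun ρ hρ hp hsafe => Game.outO_complete hvalid hv hs hρ hp hsafe,
      fun P hP Q hPQ => by
        rw [Set.mem_ofPred_eq] at hP ⊢
        exact Game.outO_upClosed hP hPQ⟩
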